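/- \textbf{Setting.} Let $\Omega\subset\mathbb R^2$ be a bounded open set and let $\mathbf g:\Omega\to\mathbb R^{2\times2}$ be a bounded measurable field of symmetric, uniformly positive definite matrices (for example $\mathbf g\in[W^{1,\infty}(\Omega)]^{2\times 2}$). Let $\Sigma\subset\Omega$ be a (possibly empty) crease, and let $\mu>0$, $\lambda\ge0$, $\gamma>0$, $\theta>0$, and integers $k\ge2$, $\ell\ge0$. $|\cdot|$ is the Euclidean (Frobenius) norm of vectors, matrices and tensors, and $L^p$ norms of such fields are those of $|\cdot|$. A conforming mesh $\mathcal T_h$ of $\Omega$ is a finite set of elements covering $\overline\Omega$ such that two different elements are disjoint or meet in a common vertex or a common edge; each element is $T=\psi_T(\hat T)$, where $\hat T$ is a reference triangle (resp. square) and $\psi_T:\hat T\to T$ is a diffeomorphism with components in $\mathbb P_k(\hat T)$ (resp. $\mathbb Q_k(\hat T)$). $h_T$ and $h_e$ denote the diameters of the element $T$ and of the edge $e$. A family of meshes is shape-regular if $|D\psi_T|\lesssim h_T$ and $|(D\psi_T)^{-1}|\lesssim h_T^{-1}$ on $\hat T$, and quasi-uniform if $h_T\lesssim h_{T'}$ for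 all elements $T,T'$ of the same mesh, with constants uniform over the family. $\mathcal E_h^0$ is the set of interior edges. A mesh resolves $\Sigma$ if $\Sigma$ is, up to endpoints of edges, a union of interior edges; $\mathcal E_h^\Sigma$ is the set of interior edges along $\Sigma$. Each interior edge $e$, shared by $T^-$ and $T^+$, has a fixed unit normal $\mathbf n_e$ pointing from $T^-$ to $T^+$. With $w^\pm$ the traces on $e$ from $T^\pm$, set $[w]=w^--w^+$ and $\{w\}=\frac12(w^++w^-)$. Define $$S_h^k=\{v\in C^0(\overline\Omega): v|_T\circ\psi_T\in\mathbb P_k\ (\text{resp. }\mathbb Q_k)\ \forall T\},\qquad V_h^\ell=\{v\in L^2(\Omega): v|_T\circ\psi_T\in\mathbb P_\ell\ (\text{resp. }\mathbb Q_\ell)\ \forall T\}.$$ For $v\in S_h^k$ let $D_h^2v$ be the elementwise Hessian, and for $e\in\mathcal E_h^0\setminus\mathcal E_h^\Sigma$ let $r_e([\nabla v])\in[V_h^\ell]^{2\times2}$ be the field supported on $\omega_e=T^-\cup T^+$ with $\int_{\omega_e}r_e([\nabla v]):\boldsymbol\tau=\int_e\{\boldsymbol\tau\}\mathbf n_e\cdot[\nabla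 v]$ for all $\boldsymbol\tau\in[V_h^\ell]^{2\times2}$. The discrete Hessian is $H_h(v)=D_h^2v-\sum_{e\in\mathcal E_h^0\setminus\mathcal E_h^\Sigma}r_e([\nabla v])$. Put $$J_h(v)=\sum_{e\in\mathcal E_h^0\setminus\mathcal E_h^\Sigma}h_e^{-1}\int_e|[\nabla v]|^2,\qquad |v|_{H_h^2}^2=\|D_h^2v\|_{L^2(\Omega)}^2+J_h(v);$$ for $\mathbf y_h=(y_1,y_2,y_3)\in[S_h^k]^3$ apply $H_h$ and $\nabla$ componentwise and sum $J_h$ and $|\cdot|_{H^2_h}^2$ over the components. The energies are $$E_h^S(\mathbf y_h)=\tfrac18\int_\Omega\Big(2\mu\big|\mathbf g^{-1/2}(\nabla\mathbf y_h^T\nabla\mathbf y_h-\mathbf g)\mathbf g^{-1/2}\big|^2+\lambda\,\mathrm{tr}\big(\mathbf g^{-1/2}(\nabla\mathbf y_h^T\nabla\mathbf y_h-\mathbf g)\mathbf g^{-1/2}\big)^2\Big),$$ $$E_h^B(\mathbf y_h)=\tfrac1{24}\sum_{m=1}^3\int_\Omega\Big(2\mu\big|\mathbf g^{-1/2}H_h(y_m)\mathbf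 g^{-1/2}\big|^2+\tfrac{2\mu\lambda}{2\mu+\lambda}\mathrm{tr}\big(\mathbf g^{-1/2}H_h(y_m)\mathbf g^{-1/2}\big)^2\Big)+\tfrac\gamma2J_h(\mathbf y_h),$$ and $E_h=E_h^S+\theta^2E_h^B$. \textbf{Theorem (partial coercivity of $E_h$).} (a) There is a constant $C_1>0$ depending only on $\mu$ such that, for every $\Omega$, $\mathbf g$, $\lambda$, $k$, every conforming mesh of $\Omega$ and every $\mathbf y_h\in[S_h^k]^3$, $$\|\nabla\mathbf y_h\|_{L^2(\Omega)}^2\le C_1\Big(|\Omega|^{1/2}\|\mathbf g\|_{L^\infty(\Omega)}E_h^S(\mathbf y_h)^{1/2}+\|\mathbf g\|_{L^1(\Omega)}\Big).$$ (b) Let $\Omega,\mathbf g,\Sigma,\mu,\lambda,k,\ell$ and a shape-regular, quasi-uniform family $\{\mathcal T_h\}$ of conforming meshes of $\Omega$ resolving $\Sigma$ be given. There is a function $\gamma\mapsto C_2(\gamma)>0$ on $(0,\infty)$ with $C_2(\gamma)\to\infty$ as $\gamma\to0^+$ such that, for all $\gamma>0$, all meshes of the family and all $\mathbf y_h\in[S_h^k]^3$,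 $$|\mathbf y_h|_{H_h^2}^2\le C_2(\gamma)\,\|\mathbf g\|_{L^\infty(\Omega)}E_h^B(\mathbf y_h).$$ (c) For all $\Omega$ and $\mathbf g$ there is $C\ge0$, depending only on $\Omega$ and $\mathbf g$, such that for all $\Sigma,\mu,\lambda,\gamma,k,\ell$ and every family of meshes as in (b) there is $K>0$ such that, for all $\theta>0$, all meshes of the family and all $\mathbf y_h\in[S_h^k]^3$, $$\|\nabla\mathbf y_h\|_{L^2(\Omega)}^4+\theta^2|\mathbf y_h|_{H_h^2}^2\le K\big(E_h(\mathbf y_h)+C\big).$$ -/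

import Mathlib

open MeasureTheory Filter Topology

noncomputable section

namespace PrestrainedPlate

/-- The plane `ℝ²` with its Euclidean norm. -/
abbrev Plane := EuclideanSpace ℝ (Fin 2)

/-! ## Matrices -/

/-- Squared Frobenius norm `|A|² = A : A`. -/
def frobSq {m n : ℕ} (A : Matrix (Fin m) (Fin n) ℝ) : ℝ := ∑ i, ∑ j, A i j ^ 2

/-- Frobenius norm `|A|`. -/
def frobNorm {m n : ℕ} (A : Matrix (Fin m) (Fin n) ℝ) : ℝ := √(frobSq A)

/-- Frobenius product `A : B`. -/
def frobInner {m n : ℕ} (A B : Matrix (Fin m) (Fin n) ℝ) : ℝ := ∑ i, ∑ j, A i j * B i j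

/-- `G^{-1/2}` for a symmetric positive definite matrix `G`: the inverse of its square root. -/
def invSqrt (G : Matrix (Fin 2) (Fin 2) ℝ) : Matrix (Fin 2) (Fin 2) ℝ := (cfc Real.sqrt G)⁻¹

/-! ## Derivatives and traces -/

/-- `∇v = (∂₁v, ∂₂v)`. A finite element function is smooth inside every element, so for it this
is the elementwise gradient; the skeleton of the mesh, where `v` need not be differentiable, is a
null set. -/
def grad (v : Plane → ℝ) (x : Plane) : Fin 2 → ℝ :=
  fun j => fderiv ℝ v x (EuclideanSpace.single j 1)

/-- `D²v = (∂ⱼ∂ₖv)ⱼₖ`; for a finite element function this is the broken (elementwise) Hessian,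
since the derivatives at a point inside an element only see the function on that element. -/
def brokenHessian (v : Plane → ℝ) (x : Plane) : Matrix (Fin 2) (Fin 2) ℝ :=
  Matrix.of fun j k => grad (fun z => grad v z k) x j

/-- `(∇y)ᵢⱼ = ∂ⱼyᵢ`. -/
def jac (y : Fin 3 → Plane → ℝ) (x : Plane) : Matrix (Fin 3) (Fin 2) ℝ :=
  Matrix.of fun i j => grad (y i) x j

/-- Trace at `x` of `w` from inside the set `U`: the limit of `w z` as `z → x`, `z ∈ U`. -/
def traceFrom (U : Set Plane) (w : Plane → ℝ) (x : Plane) : ℝ := limUnder (𝓝[U] x) w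

/-! ## Reference cells -/

/-- The two kinds of reference cells. -/
inductive RefCell where
  | triangle
  | quadrilateral

namespace RefCell

/-- Number of vertices, which is also the number of edges. -/
def numVertices : RefCell → ℕ
  | triangle => 3
  | quadrilateral => 4

/-- The vertices of the unit triangle and of the unit square, counterclockwise. -/
def vertex : (s : RefCell) → Fin s.numVertices → Plane
  | triangle => ![!₂[0, 0], !₂[1, 0], !₂[0, 1]]
  | quadrilateral => ![!₂[0, 0], !₂[1, 0], !₂[1, 1], !₂[0, 1]]

/-- The closed reference cell. -/
def cell (s : RefCell) : Set Plane := convexHull ℝ (Set.range s.vertex)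

/-- The `a`-th closed edge, from vertex `a` to its counterclockwise successor. -/
def edge (s : RefCell) (a : Fin s.numVertices) : Set Plane :=
  segment ℝ (s.vertex a) (s.vertex (finRotate _ a))

/-- The `a`-th edge without its endpoints. -/
def openEdge (s : RefCell) (a : Fin s.numVertices) : Set Plane :=
  openSegment ℝ (s.vertex a) (s.vertex (finRotate _ a))

/-- An outward normal vector to the `a`-th edge: the tangent turned by `-π/2`. -/
def normal (s : RefCell) (a : Fin s.numVertices) : Fin 2 → ℝ :=
  ![s.vertex (finRotate _ a) 1 - s.vertex a 1, -(s.vertex (finRotate _ a) 0 - s.vertex a 0)]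

/-- `ℙ_r` on the triangle, `ℚ_r` on the quadrilateral. -/
def polySpace (s : RefCell) (r : ℕ) : Submodule ℝ (MvPolynomial (Fin 2) ℝ) :=
  match s with
  | triangle => MvPolynomial.restrictTotalDegree (Fin 2) ℝ r
  | quadrilateral => MvPolynomial.restrictDegree (Fin 2) ℝ r

end RefCell

/-- Value of a polynomial in two variables at a point of the plane. -/
def polyEval (p : MvPolynomial (Fin 2) ℝ) (x : Plane) : ℝ := MvPolynomial.eval (fun i => x i) p

/-! ## Isoparametric elements -/

/-- An isoparametric element of degree `k`: a reference cell together with a diffeomorphism `ψ` of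
the closed cell onto its image, with components in `ℙ_k` (resp. `ℚ_k`). -/
structure IsoElement (k : ℕ) where
  ref : RefCell
  ψ : Fin 2 → MvPolynomial (Fin 2) ℝ
  ψ_mem : ∀ i, ψ i ∈ ref.polySpace k
  injOn : Set.InjOn (fun z : Plane => (!₂[polyEval (ψ 0) z, polyEval (ψ 1) z] : Plane)) ref.cell
  det_ne_zero : ∀ z ∈ ref.cell,
    (Matrix.of fun i j => polyEval (MvPolynomial.pderiv j (ψ i)) z).det ≠ 0

namespace IsoElement

variable {k : ℕ}

/-- The map `ψ_T`. -/
def map (T : IsoElement k) (z : Plane) : Plane := !₂[polyEval (T.ψ 0) z, polyEval (T.ψ 1) z]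

/-- The inverse of `ψ_T` on the element. -/
def inv (T : IsoElement k) : Plane → Plane := Function.invFunOn T.map T.ref.cell

/-- The Jacobian matrix `Dψ_T`. -/
def jacobian (T : IsoElement k) (z : Plane) : Matrix (Fin 2) (Fin 2) ℝ :=
  Matrix.of fun i j => polyEval (MvPolynomial.pderiv j (T.ψ i)) z

/-- The closed element `T`. -/
def carrier (T : IsoElement k) : Set Plane := T.map '' T.ref.cell

/-- The interior of the element. -/
def openCell (T : IsoElement k) : Set Plane := T.map '' interior T.ref.cell

/-- The `a`-th vertex of `T`. -/
def vertex (T : IsoElement k) (a : Fin T.ref.numVertices) : Plane := T.map (T.ref.vertex a)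

/-- The `a`-th (closed, possibly curved) edge of `T`. -/
def edge (T : IsoElement k) (a : Fin T.ref.numVertices) : Set Plane := T.map '' T.ref.edge a

/-- The `a`-th edge of `T` without its endpoints. -/
def openEdge (T : IsoElement k) (a : Fin T.ref.numVertices) : Set Plane :=
  T.map '' T.ref.openEdge a

/-- The diameter `h_T`. -/
def diam (T : IsoElement k) : ℝ := Metric.diam T.carrier

/-- The outward unit normal to `T` at a point `x` of its `a`-th edge: the normalization of
`(Dψ_T)^{-T} n̂`, where `n̂` is the outward normal to the edge of the reference cell. -/
def unitNormal (T : IsoElement k) (a : Fin T.ref.numVertices) (x : Plane) : Fin 2 → ℝ :=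
  let w := ((T.jacobian (T.inv x))⁻¹).transpose.mulVec (T.ref.normal a)
  (√(w ⬝ᵥ w))⁻¹ • w

end IsoElement

/-! ## Meshes -/

/-- A conforming subdivision of `Ω` into finitely many isoparametric elements of degree `k`: two
different elements are disjoint, or meet in a common vertex or in a common edge. -/
structure IsoMesh (k : ℕ) (Ω : Set Plane) where
  N : ℕ
  elem : Fin N → IsoElement k
  cover : ⋃ i, (elem i).carrier = closure Ω
  conforming : ∀ i j, i ≠ j →
    (elem i).carrier ∩ (elem j).carrier = ∅ ∨
    (∃ a b, (elem i).carrier ∩ (elem j).carrier = {(elem i).vertex a} ∧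
      (elem i).vertex a = (elem j).vertex b) ∨
    (∃ a b, (elem i).carrier ∩ (elem j).carrier = (elem i).edge a ∧
      (elem i).edge a = (elem j).edge b)

namespace IsoMesh

variable {k : ℕ} {Ω : Set Plane}

/-- The index `⟨i, j, a⟩` stands for the `a`-th edge of the `i`-th element, the `j`-th element
being the candidate for the element on the other side. -/
abbrev EdgeIndex (M : IsoMesh k Ω) :=
  Σ i : Fin M.N, Fin M.N × Fin (M.elem i).ref.numVertices

/-- The element `T⁻` of an edge; the fixed unit normal `n_e` points out of it. -/
def minus (M : IsoMesh k Ω) (e : M.EdgeIndex) : IsoElement k := M.elem e.1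

/-- The element `T⁺` of an edge; the fixed unit normal `n_e` points into it. -/
def plus (M : IsoMesh k Ω) (e : M.EdgeIndex) : IsoElement k := M.elem e.2.1

/-- The edge as a closed set of points. -/
def edgeSet (M : IsoMesh k Ω) (e : M.EdgeIndex) : Set Plane := (M.elem e.1).edge e.2.2

/-- The edge without its endpoints. -/
def openEdgeSet (M : IsoMesh k Ω) (e : M.EdgeIndex) : Set Plane := (M.elem e.1).openEdge e.2.2

/-- The diameter `h_e`. -/
def edgeDiam (M : IsoMesh k Ω) (e : M.EdgeIndex) : ℝ := Metric.diam (M.edgeSet e)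

/-- The fixed unit normal `n_e`. -/
def edgeNormal (M : IsoMesh k Ω) (e : M.EdgeIndex) (x : Plane) : Fin 2 → ℝ :=
  (M.elem e.1).unitNormal e.2.2 x

open Classical in
/-- The interior edges: those common to two elements and, up to their endpoints, inside `Ω`. The
condition `i < j` makes every edge occur once and fixes the direction of its normal. -/
def interiorEdges (M : IsoMesh k Ω) : Finset M.EdgeIndex :=
  Finset.univ.filter fun e => e.1 < e.2.1 ∧
    (M.minus e).carrier ∩ (M.plus e).carrier = M.edgeSet e ∧
    (∃ b, M.edgeSet e = (M.plus e).edge b) ∧ M.openEdgeSet e ⊆ Ω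

/-- The crease is resolved by the mesh: it is made of interior edges (up to endpoints). -/
def Resolves (M : IsoMesh k Ω) (crease : Set Plane) : Prop :=
  (crease ⊆ ⋃ e ∈ M.interiorEdges, M.edgeSet e) ∧
  ∀ e ∈ M.interiorEdges, M.openEdgeSet e ⊆ crease ∨ Disjoint (M.openEdgeSet e) crease

open Classical in
/-- The interior edges that do not lie along the crease. -/
def freeEdges (M : IsoMesh k Ω) (crease : Set Plane) : Finset M.EdgeIndex :=
  M.interiorEdges.filter fun e => ¬ M.openEdgeSet e ⊆ crease

/-- The space `S_h^k` (only the values on the closure of `Ω` matter). -/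
def femSpace (M : IsoMesh k Ω) : Set (Plane → ℝ) :=
  {v | ContinuousOn v (closure Ω) ∧ ∀ i, ∃ p ∈ (M.elem i).ref.polySpace k,
    ∀ z ∈ (M.elem i).ref.cell, v ((M.elem i).map z) = polyEval p z}

/-- The broken space `V_h^ℓ` (the values on the skeleton, a null set, do not matter). -/
def brokenSpace (M : IsoMesh k Ω) (l : ℕ) : Set (Plane → ℝ) :=
  {w | ∀ i, ∃ p ∈ (M.elem i).ref.polySpace l,
    ∀ z ∈ interior (M.elem i).ref.cell, w ((M.elem i).map z) = polyEval p z}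

/-- The space `[V_h^ℓ]^{2×2}`. -/
def brokenMatrixSpace (M : IsoMesh k Ω) (l : ℕ) : Set (Plane → Matrix (Fin 2) (Fin 2) ℝ) :=
  {τ | ∀ a b, (fun x => τ x a b) ∈ M.brokenSpace l}

/-- The jump `[w] = w⁻ - w⁺` over an edge. -/
def jump (M : IsoMesh k Ω) (e : M.EdgeIndex) (w : Plane → ℝ) (x : Plane) : ℝ :=
  traceFrom (M.minus e).openCell w x - traceFrom (M.plus e).openCell w x

/-- The average `{w} = (w⁺ + w⁻) / 2` on an edge. -/
def avg (M : IsoMesh k Ω) (e : M.EdgeIndex) (w : Plane → ℝ) (x : Plane) : ℝ :=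
  (traceFrom (M.plus e).openCell w x + traceFrom (M.minus e).openCell w x) / 2

/-- The jump of the gradient `[∇v]` over an edge. -/
def jumpGrad (M : IsoMesh k Ω) (e : M.EdgeIndex) (v : Plane → ℝ) (x : Plane) : Fin 2 → ℝ :=
  fun j => M.jump e (fun z => grad v z j) x

/-- The average of a matrix field on an edge. -/
def avgMatrix (M : IsoMesh k Ω) (e : M.EdgeIndex) (τ : Plane → Matrix (Fin 2) (Fin 2) ℝ)
    (x : Plane) : Matrix (Fin 2) (Fin 2) ℝ :=
  Matrix.of fun a b => M.avg e (fun z => τ z a b) x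

/-- `r` is the local lifting `r_e(φ)`: it belongs to `[V_h^ℓ]^{2×2}`, vanishes outside the union
`ω_e` of the two elements sharing `e`, and
`∫_{ω_e} r : τ = ∫_e {τ} n_e · φ` for all `τ ∈ [V_h^ℓ]^{2×2}`. The integral over `e` is with
respect to arc length, that is, the one-dimensional Hausdorff measure. -/
def IsLocalLifting (M : IsoMesh k Ω) (l : ℕ) (e : M.EdgeIndex) (φ : Plane → Fin 2 → ℝ)
    (r : Plane → Matrix (Fin 2) (Fin 2) ℝ) : Prop :=
  r ∈ M.brokenMatrixSpace l ∧
  (∀ x, x ∉ (M.minus e).carrier ∪ (M.plus e).carrier → r x = 0) ∧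
  ∀ τ ∈ M.brokenMatrixSpace l,
    ∫ x in (M.minus e).carrier ∪ (M.plus e).carrier, frobInner (r x) (τ x) =
      ∫ x in M.edgeSet e, (M.avgMatrix e τ x).mulVec (M.edgeNormal e x) ⬝ᵥ φ x
        ∂(Measure.hausdorffMeasure 1)

open Classical in
/-- The local lifting `r_e(φ)`, which by the Riesz theorem in the finite-dimensional space
`[V_h^ℓ]^{2×2}` on `ω_e` exists, and is unique almost everywhere, for all `φ ∈ [L²(e)]²`. -/
def localLifting (M : IsoMesh k Ω) (l : ℕ) (e : M.EdgeIndex) (φ : Plane → Fin 2 → ℝ) :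
    Plane → Matrix (Fin 2) (Fin 2) ℝ :=
  if h : ∃ r, M.IsLocalLifting l e φ r then h.choose else 0

/-- The discrete Hessian `H_h(v) = D_h²v - R_h([∇v])`, where `R_h = ∑ₑ r_e` over the interior
edges that do not lie along the crease. -/
def discreteHessian (M : IsoMesh k Ω) (crease : Set Plane) (l : ℕ) (v : Plane → ℝ) (x : Plane) :
    Matrix (Fin 2) (Fin 2) ℝ :=
  brokenHessian v x - ∑ e ∈ M.freeEdges crease, M.localLifting l e (M.jumpGrad e v) x

/-- `‖𝐡^{-1/2} [∇v]‖²` in `L²(Γ_h^0 \ Σ)`. -/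
def jumpNormSq (M : IsoMesh k Ω) (crease : Set Plane) (v : Plane → ℝ) : ℝ :=
  ∑ e ∈ M.freeEdges crease, ∫ x in M.edgeSet e,
    (M.edgeDiam e)⁻¹ * (M.jumpGrad e v x ⬝ᵥ M.jumpGrad e v x) ∂(Measure.hausdorffMeasure 1)

/-- The squared discrete seminorm `|v|²` in `H_h²(Ω)`. -/
def seminormSq (M : IsoMesh k Ω) (crease : Set Plane) (v : Plane → ℝ) : ℝ :=
  (∫ x in Ω, frobSq (brokenHessian v x)) + M.jumpNormSq crease v

/-- The squared discrete seminorm `|y|²` in `H_h²(Ω)` of a deformation. -/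
def deformationSeminormSq (M : IsoMesh k Ω) (crease : Set Plane) (y : Fin 3 → Plane → ℝ) : ℝ :=
  ∑ m, M.seminormSq crease (y m)

/-- The space `[S_h^k]³`. -/
def deformationSpace (M : IsoMesh k Ω) : Set (Fin 3 → Plane → ℝ) :=
  {y | ∀ m, y m ∈ M.femSpace}

/-- The discrete bending energy `E_h^B`. -/
def bendingEnergy (M : IsoMesh k Ω) (crease : Set Plane) (l : ℕ) (μ lam γ : ℝ)
    (g : Plane → Matrix (Fin 2) (Fin 2) ℝ) (y : Fin 3 → Plane → ℝ) : ℝ :=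
  1 / 24 * (∫ x in Ω,
    (2 * μ * (∑ m, frobSq
        (invSqrt (g x) * M.discreteHessian crease l (y m) x * invSqrt (g x))) +
      2 * μ * lam / (2 * μ + lam) * (∑ m,
        (invSqrt (g x) * M.discreteHessian crease l (y m) x * invSqrt (g x)).trace ^ 2)))
  + γ / 2 * ∑ m, M.jumpNormSq crease (y m)

end IsoMesh

/-- The stretching energy `E_h^S`. -/
def stretchingEnergy (Ω : Set Plane) (μ lam : ℝ) (g : Plane → Matrix (Fin 2) (Fin 2) ℝ)
    (y : Fin 3 → Plane → ℝ) : ℝ :=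
  1 / 8 * (∫ x in Ω,
    (2 * μ * frobSq
        (invSqrt (g x) * ((jac y x).transpose * jac y x - g x) * invSqrt (g x)) +
      lam *
        (invSqrt (g x) * ((jac y x).transpose * jac y x - g x) * invSqrt (g x)).trace ^ 2))

/-- The total discrete energy `E_h = E_h^S + θ² E_h^B`. -/
def IsoMesh.energy {k : ℕ} {Ω : Set Plane} (M : IsoMesh k Ω) (crease : Set Plane) (l : ℕ)
    (μ lam γ θ : ℝ) (g : Plane → Matrix (Fin 2) (Fin 2) ℝ) (y : Fin 3 → Plane → ℝ) : ℝ :=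
  stretchingEnergy Ω μ lam g y + θ ^ 2 * M.bendingEnergy crease l μ lam γ g y

/-- `‖∇y‖²` in `L²(Ω)`. -/
def gradNormSq (Ω : Set Plane) (y : Fin 3 → Plane → ℝ) : ℝ := ∫ x in Ω, frobSq (jac y x)

/-- `‖g‖` in `L^∞(Ω)`. -/
def metricSup (Ω : Set Plane) (g : Plane → Matrix (Fin 2) (Fin 2) ℝ) : ℝ :=
  (eLpNorm (fun x => frobNorm (g x)) ⊤ (volume.restrict Ω)).toReal

/-- `‖g‖` in `L¹(Ω)`. -/
def metricL1 (Ω : Set Plane) (g : Plane → Matrix (Fin 2) (Fin 2) ℝ) : ℝ :=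
  ∫ x in Ω, frobNorm (g x)

/-- A target metric on `Ω`: a bounded measurable field of symmetric, uniformly positive definite
matrices. Only the values almost everywhere in `Ω` matter. -/
structure IsTargetMetric (Ω : Set Plane) (g : Plane → Matrix (Fin 2) (Fin 2) ℝ) : Prop where
  aemeasurable : ∀ a b, AEMeasurable (fun x => g x a b) (volume.restrict Ω)
  bounded : ∃ c : ℝ, ∀ᵐ x ∂(volume.restrict Ω), frobNorm (g x) ≤ c
  symm : ∀ᵐ x ∂(volume.restrict Ω), (g x).IsSymm
  pos : ∃ c : ℝ, 0 < c ∧ ∀ᵐ x ∂(volume.restrict Ω), ∀ ξ : Fin 2 → ℝ,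
    c * (ξ ⬝ᵥ ξ) ≤ ξ ⬝ᵥ (g x).mulVec ξ

/-- Shape regularity of a family of isoparametric meshes: `‖Dψ_T‖ ≲ h_T` and
`‖(Dψ_T)⁻¹‖ ≲ h_T⁻¹`, uniformly over all elements of all meshes of the family. -/
def ShapeRegular {k : ℕ} {Ω : Set Plane} {ι : Type} (M : ι → IsoMesh k Ω) : Prop :=
  ∃ σ : ℝ, ∀ h i, ∀ z ∈ ((M h).elem i).ref.cell,
    frobNorm (((M h).elem i).jacobian z) ≤ σ * ((M h).elem i).diam ∧
    frobNorm (((M h).elem i).jacobian z)⁻¹ ≤ σ * (((M h).elem i).diam)⁻¹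

/-- Quasi-uniformity of a family of meshes: in each mesh all elements have comparable diameters,
uniformly over the family. -/
def QuasiUniform {k : ℕ} {Ω : Set Plane} {ι : Type} (M : ι → IsoMesh k Ω) : Prop :=
  ∃ σ : ℝ, ∀ h i j, ((M h).elem i).diam ≤ σ * ((M h).elem j).diam

end PrestrainedPlate

end

open PrestrainedPlate

/-!
Since `tr (∇yᵀ∇y) = |∇y|²`, the gradient is controlled by `|∇yᵀ∇y - g| + |g|`. The energies see the
conjugates `g^{-1/2} A g^{-1/2}`, and `|A| ≤ |g| |g^{-1/2} A g^{-1/2}|`; the Cauchy–Schwarz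
inequality then gives the gradient bound.

For the second-order bound write `D_h² v = H_h(v) + ∑ₑ r_e([∇v])`. Testing the equation that defines
`r_e` with `r_e` itself, and bounding the trace of `r_e` on `e` by its `L²` norm on the two
neighbouring elements (all norms on the polynomials on the reference cell are equivalent, and the
edge has length at most a multiple of `h`), Young's inequality yields
`‖r_e([∇v])‖² ≲ h_e⁻¹ ‖[∇v]‖²_{L²(e)}`. Comparing areas, only boundedly many liftings overlap at a
point, so their sum is controlled by the jump term. The energy controls that term only through the
penalty, with factor `γ`, whence the constant of order `γ⁻¹`.

The combined bound adds the square of the first to `θ²` times the second.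
-/

noncomputable section

namespace PrestrainedPlate

section Frobenius

variable {m n p : ℕ}

lemma frobSq_nonneg (A : Matrix (Fin m) (Fin n) ℝ) : 0 ≤ frobSq A := by
  unfold frobSq; positivity

lemma frobNorm_nonneg (A : Matrix (Fin m) (Fin n) ℝ) : 0 ≤ frobNorm A := Real.sqrt_nonneg _

lemma frobNorm_sq (A : Matrix (Fin m) (Fin n) ℝ) : frobNorm A ^ 2 = frobSq A :=
  Real.sq_sqrt (frobSq_nonneg A)

lemma sq_apply_le_frobSq (A : Matrix (Fin m) (Fin n) ℝ) (i : Fin m) (j : Fin n) :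
    A i j ^ 2 ≤ frobSq A :=
  (Finset.single_le_sum (f := fun j => A i j ^ 2) (fun _ _ => sq_nonneg _)
    (Finset.mem_univ j)).trans
  (Finset.single_le_sum (f := fun i => ∑ j, A i j ^ 2)
    (fun _ _ => Finset.sum_nonneg fun _ _ => sq_nonneg _) (Finset.mem_univ i))

lemma abs_apply_le_frobNorm (A : Matrix (Fin m) (Fin n) ℝ) (i : Fin m) (j : Fin n) :
    |A i j| ≤ frobNorm A := Real.abs_le_sqrt (sq_apply_le_frobSq A i j)

lemma frobInner_self (A : Matrix (Fin m) (Fin n) ℝ) : frobInner A A = frobSq A := by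
  simp [frobInner, frobSq, pow_two]

lemma frobInner_eq_trace (A B : Matrix (Fin m) (Fin n) ℝ) :
    frobInner A B = (A * B.transpose).trace := by
  simp only [frobInner, Matrix.trace, Matrix.diag, Matrix.mul_apply, Matrix.transpose_apply]

lemma frobInner_sq_le (A B : Matrix (Fin m) (Fin n) ℝ) :
    frobInner A B ^ 2 ≤ frobSq A * frobSq B := by
  have := Finset.sum_mul_sq_le_sq_mul_sq (Finset.univ : Finset (Fin m × Fin n))
    (fun q => A q.1 q.2) (fun q => B q.1 q.2)
  simpa only [frobInner, frobSq, Fintype.sum_prod_type] using this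

lemma frobSq_mul_le (A : Matrix (Fin m) (Fin n) ℝ) (B : Matrix (Fin n) (Fin p) ℝ) :
    frobSq (A * B) ≤ frobSq A * frobSq B := by
  calc frobSq (A * B) ≤ ∑ i, ∑ j, (∑ k, A i k ^ 2) * ∑ k, B k j ^ 2 :=
        Finset.sum_le_sum fun i _ => Finset.sum_le_sum fun j _ => by
          rw [Matrix.mul_apply]; exact Finset.sum_mul_sq_le_sq_mul_sq _ _ _
    _ = frobSq A * frobSq B := by
        rw [← Finset.sum_mul_sum, frobSq, frobSq, Finset.sum_comm (f := fun k j => B k j ^ 2)]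

lemma frobSq_add_le (A B : Matrix (Fin m) (Fin n) ℝ) :
    frobSq (A + B) ≤ 2 * frobSq A + 2 * frobSq B := by
  simp only [frobSq, Finset.mul_sum, ← Finset.sum_add_distrib]
  refine Finset.sum_le_sum fun i _ => Finset.sum_le_sum fun j _ => ?_
  rw [Matrix.add_apply]
  linarith [add_sq_le (a := A i j) (b := B i j)]

lemma frobSq_sum_le {ι : Type*} (s : Finset ι) (A : ι → Matrix (Fin m) (Fin n) ℝ) :
    frobSq (∑ e ∈ s, A e) ≤ s.card * ∑ e ∈ s, frobSq (A e) := by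
  have hswap : ∑ e ∈ s, frobSq (A e) = ∑ i, ∑ j, ∑ e ∈ s, A e i j ^ 2 := by
    simp only [frobSq]
    rw [Finset.sum_comm]
    exact Finset.sum_congr rfl fun i _ => Finset.sum_comm
  rw [hswap]
  simp only [frobSq, Finset.mul_sum (s := Finset.univ), Matrix.sum_apply]
  exact Finset.sum_le_sum fun i _ => Finset.sum_le_sum fun j _ => sq_sum_le_card_mul_sum_sq

lemma trace_sq_le (A : Matrix (Fin n) (Fin n) ℝ) : A.trace ^ 2 ≤ n * frobSq A := by
  have hdiag : ∑ i, A i i ^ 2 ≤ frobSq A := Finset.sum_le_sum fun i _ =>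
    Finset.single_le_sum (f := fun j => A i j ^ 2) (fun _ _ => sq_nonneg _) (Finset.mem_univ i)
  calc A.trace ^ 2 ≤ n * ∑ i, A i i ^ 2 := by
        simpa [Matrix.trace] using
          sq_sum_le_card_mul_sum_sq (s := (Finset.univ : Finset (Fin n))) (f := fun i => A i i)
    _ ≤ n * frobSq A := by gcongr

lemma trace_le_sqrt_mul_frobNorm (A : Matrix (Fin n) (Fin n) ℝ) : A.trace ≤ √n * frobNorm A := by
  rw [frobNorm, ← Real.sqrt_mul n.cast_nonneg]
  exact Real.le_sqrt_of_sq_le (trace_sq_le A)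

lemma trace_transpose_mul_self (A : Matrix (Fin m) (Fin n) ℝ) :
    (A.transpose * A).trace = frobSq A := by
  rw [Matrix.trace_mul_comm, ← frobInner_eq_trace, frobInner_self]

lemma sum_sq_mulVec_le (A : Matrix (Fin m) (Fin n) ℝ) (v : Fin n → ℝ) :
    ∑ i, A.mulVec v i ^ 2 ≤ frobSq A * ∑ j, v j ^ 2 := by
  rw [frobSq, Finset.sum_mul]
  exact Finset.sum_le_sum fun i _ => Finset.sum_mul_sq_le_sq_mul_sq Finset.univ (A i) v

lemma dotProduct_mulVec_sq_le (A : Matrix (Fin m) (Fin n) ℝ) (v : Fin n → ℝ) (w : Fin m → ℝ) :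
    (A.mulVec v ⬝ᵥ w) ^ 2 ≤ frobSq A * (v ⬝ᵥ v) * (w ⬝ᵥ w) := by
  simp only [dotProduct, ← sq]
  exact (Finset.sum_mul_sq_le_sq_mul_sq _ _ _).trans
    (mul_le_mul_of_nonneg_right (sum_sq_mulVec_le A v) (by positivity))

lemma norm_toEuclideanCLM_le (A : Matrix (Fin n) (Fin n) ℝ) :
    ‖Matrix.toEuclideanCLM (𝕜 := ℝ) A‖ ≤ frobNorm A := by
  refine ContinuousLinearMap.opNorm_le_bound _ (frobNorm_nonneg A) fun v => ?_
  refine abs_le_of_sq_le_sq' ?_ (mul_nonneg (frobNorm_nonneg A) (norm_nonneg v)) |>.2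
  rw [mul_pow, frobNorm_sq, EuclideanSpace.real_norm_sq_eq, EuclideanSpace.real_norm_sq_eq]
  simpa using sum_sq_mulVec_le A (WithLp.ofLp v)

lemma abs_det_fin_two_le_frobSq (A : Matrix (Fin 2) (Fin 2) ℝ) : |A.det| ≤ frobSq A := by
  rw [Matrix.det_fin_two, frobSq]
  simp only [Fin.sum_univ_two]
  rw [abs_le]
  constructor <;>
    nlinarith [sq_nonneg (A 0 0 - A 1 1), sq_nonneg (A 0 1 + A 1 0), sq_nonneg (A 0 0 + A 1 1),
      sq_nonneg (A 0 1 - A 1 0)]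

/- `|SBS|² = (S²B) : (BS²)` by cyclicity of the trace, so that only `|S²|`, and not `|S|²`, enters
the Cauchy–Schwarz bound. -/
lemma frobSq_conj_le {S : Matrix (Fin n) (Fin n) ℝ} (hS : S.IsSymm)
    (B : Matrix (Fin n) (Fin n) ℝ) : frobSq (S * B * S) ≤ frobSq (S * S) * frobSq B := by
  have hcyc : frobSq (S * B * S) = frobInner (S * S * B) (B * (S * S)) := by
    rw [← frobInner_self, frobInner_eq_trace, frobInner_eq_trace]
    simp only [Matrix.transpose_mul, hS.eq, Matrix.mul_assoc]
    iterate 3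
      rw [Matrix.trace_mul_comm S]
      simp only [Matrix.mul_assoc]
  have hprod : frobInner (S * S * B) (B * (S * S)) ^ 2 ≤ (frobSq (S * S) * frobSq B) ^ 2 :=
    (frobInner_sq_le _ _).trans <|
      (mul_le_mul (frobSq_mul_le _ _) (frobSq_mul_le _ _) (frobSq_nonneg _)
        (mul_nonneg (frobSq_nonneg _) (frobSq_nonneg _))).trans_eq (by ring)
  rw [hcyc]
  exact (abs_le_of_sq_le_sq' hprod (mul_nonneg (frobSq_nonneg _) (frobSq_nonneg _))).2

end Frobenius

section PositiveDefinite

variable {n : Type*} [Fintype n] {G : Matrix n n ℝ}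

lemma posDef_of_le_dotProduct_mulVec (hG : G.IsSymm) {c : ℝ} (hc : 0 < c)
    (hpos : ∀ ξ : n → ℝ, c * (ξ ⬝ᵥ ξ) ≤ ξ ⬝ᵥ G.mulVec ξ) : G.PosDef := by
  refine Matrix.PosDef.of_dotProduct_mulVec_pos hG fun ξ hξ => ?_
  have : 0 < ξ ⬝ᵥ ξ := by simpa using Matrix.dotProduct_star_self_pos_iff.2 hξ
  simpa using (mul_pos hc this).trans_le (hpos ξ)

variable [DecidableEq n]

lemma pow_card_le_det (hG : G.IsSymm) {c : ℝ} (hc : 0 ≤ c)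
    (hpos : ∀ ξ : n → ℝ, c * (ξ ⬝ᵥ ξ) ≤ ξ ⬝ᵥ G.mulVec ξ) : c ^ Fintype.card n ≤ G.det := by
  have hH : G.IsHermitian := hG
  have heig : ∀ i, c ≤ hH.eigenvalues i := fun i => by
    have hunit : (hH.eigenvectorBasis i).ofLp ⬝ᵥ (hH.eigenvectorBasis i).ofLp = 1 := by
      have h := hH.eigenvectorBasis.orthonormal.1 i
      rw [EuclideanSpace.norm_eq, Real.sqrt_eq_one] at h
      simpa [dotProduct, ← sq] using h
    have h := hpos (hH.eigenvectorBasis i).ofLp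
    rwa [hunit, mul_one, hH.mulVec_eigenvectorBasis, dotProduct_smul, hunit, smul_eq_mul,
      mul_one] at h
  rw [hH.det_eq_prod_eigenvalues]
  calc c ^ Fintype.card n = ∏ _i : n, c := by simp
    _ ≤ ∏ i, hH.eigenvalues i := Finset.prod_le_prod (fun _ _ => hc) fun i _ => heig i

lemma cfc_sqrt_mul_self (hG : G.PosSemidef) : cfc Real.sqrt G * cfc Real.sqrt G = G := by
  have hspec := (Matrix.posSemidef_iff_isHermitian_and_spectrum_nonneg.1 hG).2
  rw [← cfc_mul _ _ G]
  conv_rhs => rw [← cfc_id ℝ G hG.isHermitian]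
  exact cfc_congr fun _ hx => Real.mul_self_sqrt (hspec hx)

open scoped MatrixOrder in
lemma posDef_cfc_sqrt (hG : G.PosDef) : (cfc Real.sqrt G).PosDef := by
  have hpsd : (cfc Real.sqrt G).PosSemidef :=
    Matrix.nonneg_iff_posSemidef.1 (cfc_nonneg fun x _ => Real.sqrt_nonneg x)
  refine hpsd.posDef_iff_isUnit.2 (isUnit_of_mul_isUnit_left (y := cfc Real.sqrt G) ?_)
  rw [cfc_sqrt_mul_self hG.posSemidef]
  exact hG.isUnit

end PositiveDefinite

section InvSqrt

variable {G : Matrix (Fin 2) (Fin 2) ℝ}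

lemma invSqrt_eq (hG : G.PosDef) :
    invSqrt G = (√(G.trace + 2 * √G.det) * √G.det)⁻¹ • (G.adjugate + √G.det • 1) := by
  have hS := posDef_cfc_sqrt hG
  have hSS := cfc_sqrt_mul_self hG.posSemidef
  rw [invSqrt]
  generalize cfc Real.sqrt G = S at hS hSS
  have hdet : √G.det = S.det := by
    rw [← hSS, Matrix.det_mul, Real.sqrt_mul_self hS.det_pos.le]
  have htr : √(G.trace + 2 * √G.det) = S.trace := by
    rw [hdet, ← Real.sqrt_sq hS.trace_pos.le, ← hSS]
    congr 1
    simp only [Matrix.trace_fin_two, Matrix.det_fin_two, Matrix.mul_apply, Fin.sum_univ_two]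
    ring
  -- Cayley–Hamilton for `S`, multiplied by `tr S`
  have hadj : S.trace • S.adjugate = G.adjugate + S.det • 1 := by
    rw [← hSS]
    ext i j
    fin_cases i <;> fin_cases j <;>
      simp [Matrix.adjugate_fin_two, Matrix.trace_fin_two, Matrix.det_fin_two, Matrix.mul_apply,
        Fin.sum_univ_two] <;> ring
  rw [htr, hdet, ← hadj, smul_smul, Matrix.inv_def, Ring.inverse_eq_inv', mul_inv_rev, mul_assoc,
    inv_mul_cancel₀ hS.trace_pos.ne', mul_one]

lemma frobSq_invSqrt (hG : G.PosDef) : frobSq (invSqrt G) = G.trace / G.det := by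
  have hS := posDef_cfc_sqrt hG
  have hsymm : (invSqrt G).transpose = invSqrt G := hS.inv.isHermitian
  rw [← trace_transpose_mul_self, hsymm, invSqrt, ← Matrix.mul_inv_rev,
    cfc_sqrt_mul_self hG.posSemidef, Matrix.inv_def, Ring.inverse_eq_inv', Matrix.trace_smul,
    Matrix.adjugate_fin_two, Matrix.trace_fin_two, Matrix.trace_fin_two, smul_eq_mul,
    div_eq_inv_mul]
  simp [add_comm]

lemma frobSq_le_mul_frobSq_conj_invSqrt (hG : G.PosDef) (A : Matrix (Fin 2) (Fin 2) ℝ) :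
    frobSq A ≤ frobSq G * frobSq (invSqrt G * A * invSqrt G) := by
  have hS := posDef_cfc_sqrt hG
  have hunit : IsUnit (cfc Real.sqrt G).det := hS.det_pos.ne'.isUnit
  have hA : A = cfc Real.sqrt G * (invSqrt G * A * invSqrt G) * cfc Real.sqrt G := by
    simp only [invSqrt, Matrix.mul_assoc, Matrix.nonsing_inv_mul _ hunit, Matrix.mul_one]
    rw [Matrix.mul_nonsing_inv_cancel_left _ _ hunit]
  calc frobSq A = frobSq (cfc Real.sqrt G * (invSqrt G * A * invSqrt G) * cfc Real.sqrt G) := by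
        rw [← hA]
    _ ≤ frobSq (cfc Real.sqrt G * cfc Real.sqrt G) * frobSq (invSqrt G * A * invSqrt G) :=
        frobSq_conj_le hS.isHermitian _
    _ = frobSq G * frobSq (invSqrt G * A * invSqrt G) := by
        rw [cfc_sqrt_mul_self hG.posSemidef]

end InvSqrt

lemma contDiff_polyEval (p : MvPolynomial (Fin 2) ℝ) {n : WithTop ℕ∞} :
    ContDiff ℝ n (polyEval p) :=
  (AnalyticOnNhd.aeval_mvPolynomial (f := fun (x : Plane) i => x i)
    (fun i => (EuclideanSpace.proj (𝕜 := ℝ) i).analyticOnNhd Set.univ) p).contDiff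

lemma continuous_polyEval (p : MvPolynomial (Fin 2) ℝ) : Continuous (polyEval p) :=
  (contDiff_polyEval p (n := 0)).continuous

lemma fderiv_polyEval (p : MvPolynomial (Fin 2) ℝ) (x : Plane) (j : Fin 2) :
    fderiv ℝ (polyEval p) x (EuclideanSpace.single j 1) =
      polyEval (MvPolynomial.pderiv j p) x := by
  have hd : ∀ p, DifferentiableAt ℝ (polyEval p) x := fun p =>
    (contDiff_polyEval p (n := 1)).differentiable one_ne_zero x
  induction p using MvPolynomial.induction_on with
  | C a =>
    have : polyEval (MvPolynomial.C a) = fun _ => a := by ext x; simp [polyEval]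
    simp [this, polyEval]
  | add p q hp hq =>
    have : polyEval (p + q) = fun x => polyEval p x + polyEval q x := by ext x; simp [polyEval]
    rw [this, fderiv_fun_add (hd p) (hd q)]
    simp [hp, hq, polyEval]
  | mul_X p i hp =>
    have : polyEval (p * MvPolynomial.X i) = fun x => polyEval p x * x i := by
      ext x; simp [polyEval]
    have hX : HasFDerivAt (fun x : Plane => x i) (EuclideanSpace.proj (𝕜 := ℝ) i) x :=
      (EuclideanSpace.proj (𝕜 := ℝ) i).hasFDerivAt
    rw [this, fderiv_fun_mul (hd p) hX.differentiableAt, hX.fderiv]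
    by_cases h : i = j
    · subst h; simp [hp, polyEval]
    · simp [hp, polyEval, MvPolynomial.pderiv_X, h]

namespace RefCell

variable (s : RefCell)

lemma isCompact_cell : IsCompact s.cell := (Set.finite_range _).isCompact_convexHull ℝ

lemma convex_cell : Convex ℝ s.cell := convex_convexHull ℝ _

lemma affineSpan_range_vertex : affineSpan ℝ (Set.range s.vertex) = ⊤ := by
  have hsub : ∀ a b, s.vertex a - s.vertex b ∈ vectorSpan ℝ (Set.range s.vertex) := fun a b =>
    vsub_mem_vectorSpan ℝ (Set.mem_range_self a) (Set.mem_range_self b)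
  have hbasis : ∀ i, EuclideanSpace.single i 1 ∈ vectorSpan ℝ (Set.range s.vertex) := fun i => by
    cases s <;> fin_cases i
    · convert hsub (1 : Fin 3) (0 : Fin 3); ext j; fin_cases j <;> simp [vertex]
    · convert hsub (2 : Fin 3) (0 : Fin 3); ext j; fin_cases j <;> simp [vertex]
    · convert hsub (1 : Fin 4) (0 : Fin 4); ext j; fin_cases j <;> simp [vertex]
    · convert hsub (3 : Fin 4) (0 : Fin 4); ext j; fin_cases j <;> simp [vertex]
  rw [← AffineSubspace.direction_eq_top_iff_of_nonempty
    ((affineSpan_nonempty ℝ).2 ⟨s.vertex ⟨0, by cases s <;> decide⟩, Set.mem_range_self _⟩),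
    direction_affineSpan, eq_top_iff, ← (EuclideanSpace.basisFun (Fin 2) ℝ).toBasis.span_eq,
    Submodule.span_le]
  rintro _ ⟨i, rfl⟩
  simpa using hbasis i

lemma nonempty_interior_cell : (interior s.cell).Nonempty :=
  interior_convexHull_nonempty_iff_affineSpan_eq_top.2 s.affineSpan_range_vertex

lemma cell_nonempty : s.cell.Nonempty := s.nonempty_interior_cell.mono interior_subset

lemma closure_interior_cell : closure (interior s.cell) = s.cell := by
  rw [s.convex_cell.closure_interior_eq_closure_of_nonempty_interior
    s.nonempty_interior_cell,
    s.isCompact_cell.isClosed.closure_eq]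

lemma edge_subset_cell (a : Fin s.numVertices) : s.edge a ⊆ s.cell :=
  segment_subset_convexHull (Set.mem_range_self _) (Set.mem_range_self _)

lemma isCompact_edge (a : Fin s.numVertices) : IsCompact (s.edge a) := by
  rw [edge, segment_eq_image_lineMap]
  exact isCompact_Icc.image (by fun_prop)

lemma volume_edge (a : Fin s.numVertices) : volume (s.edge a) = 0 := by
  have hline : s.edge a ⊆ line[ℝ, s.vertex a, s.vertex (finRotate _ a)] := by
    rw [edge, ← convexHull_pair]; exact convexHull_subset_affineSpan _
  refine measure_mono_null hline (Measure.addHaar_affineSubspace volume _ fun htop => ?_)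
  have hdim := collinear_iff_finrank_le_one.1 (collinear_pair ℝ (s.vertex a)
    (s.vertex (finRotate _ a)))
  rw [← direction_affineSpan, htop, AffineSubspace.direction_top, finrank_top] at hdim
  simp at hdim

lemma dist_vertex_le (a b : Fin s.numVertices) : dist (s.vertex a) (s.vertex b) ≤ 2 := by
  rw [EuclideanSpace.dist_eq, Real.sqrt_le_left (by norm_num), Fin.sum_univ_two]
  cases s
  · change Fin 3 at a b
    fin_cases a <;> fin_cases b <;> norm_num [vertex, Real.dist_eq]
  · change Fin 4 at a b
    fin_cases a <;> fin_cases b <;> norm_num [vertex, Real.dist_eq]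

lemma vertex_injective : Function.Injective s.vertex := by
  intro a b h
  have h0 := congrArg (fun p : Plane => p 0) h
  have h1 := congrArg (fun p : Plane => p 1) h
  cases s
  · change Fin 3 at a b
    fin_cases a <;> fin_cases b <;> first | rfl | (exfalso; simp [vertex] at h0 h1)
  · change Fin 4 at a b
    fin_cases a <;> fin_cases b <;> first | rfl | (exfalso; simp [vertex] at h0 h1)

lemma vertex_ne_vertex_finRotate (a : Fin s.numVertices) :
    s.vertex a ≠ s.vertex (finRotate _ a) := by
  refine s.vertex_injective.ne ?_
  cases s
  · exact (by decide : ∀ a : Fin 3, a ≠ finRotate 3 a) a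
  · exact (by decide : ∀ a : Fin 4, a ≠ finRotate 4 a) a

end RefCell

lemma eqOn_traceFrom {U s : Set Plane} (hUs : U ⊆ s) (hsU : s ⊆ closure U) {w f : Plane → ℝ}
    (hf : ContinuousOn f s) (hwf : Set.EqOn w f U) : Set.EqOn (traceFrom U w) f s := by
  intro x hx
  have : (𝓝[U] x).NeBot := mem_closure_iff_nhdsWithin_neBot.1 (hsU hx)
  refine (((hf x hx).mono hUs).tendsto.congr' ?_).limUnder_eq
  filter_upwards [self_mem_nhdsWithin] with y hy using (hwf hy).symm

namespace IsoElement

variable {k : ℕ} (T : IsoElement k)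

lemma contDiff_map {n : WithTop ℕ∞} : ContDiff ℝ n T.map := by
  rw [contDiff_euclidean]
  intro i
  fin_cases i
  · exact contDiff_polyEval (T.ψ 0)
  · exact contDiff_polyEval (T.ψ 1)

lemma continuous_map : Continuous T.map := (T.contDiff_map (n := 0)).continuous

lemma hasStrictFDerivAt_map (z : Plane) : HasStrictFDerivAt T.map (fderiv ℝ T.map z) z :=
  (T.contDiff_map (n := 1)).contDiffAt.hasStrictFDerivAt one_ne_zero

lemma fderiv_map (z : Plane) :
    fderiv ℝ T.map z = Matrix.toEuclideanCLM (𝕜 := ℝ) (T.jacobian z) := by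
  have hcomp : ∀ (i : Fin 2) (v : Plane),
      fderiv ℝ T.map z v i = fderiv ℝ (polyEval (T.ψ i)) z v := fun i v => by
    have h := ((EuclideanSpace.proj (𝕜 := ℝ) i).hasFDerivAt.comp z
      (T.hasStrictFDerivAt_map z).hasFDerivAt).fderiv
    have hψ : ⇑(EuclideanSpace.proj (𝕜 := ℝ) i) ∘ T.map = polyEval (T.ψ i) := by
      ext x; fin_cases i <;> simp [map]
    rw [← hψ, h]
    rfl
  refine ContinuousLinearMap.coe_injective
    ((EuclideanSpace.basisFun (Fin 2) ℝ).toBasis.ext fun j => ?_)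
  ext i
  simp [hcomp, fderiv_polyEval, jacobian]

lemma det_fderiv_map (z : Plane) : (fderiv ℝ T.map z).det = (T.jacobian z).det := by
  rw [fderiv_map, ContinuousLinearMap.det, Matrix.coe_toEuclideanCLM_eq_toEuclideanLin]
  exact LinearMap.det_toLin (PiLp.basisFun 2 ℝ (Fin 2)) _

lemma exists_continuousLinearEquiv_fderiv_map {z : Plane} (hz : z ∈ T.ref.cell) :
    ∃ L : Plane ≃L[ℝ] Plane, (L : Plane →L[ℝ] Plane) = fderiv ℝ T.map z := by
  have h : (fderiv ℝ T.map z).det ≠ 0 := by rw [det_fderiv_map]; exact T.det_ne_zero z hz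
  exact ⟨_, ContinuousLinearMap.coe_toContinuousLinearEquivOfDetNeZero _ h⟩

lemma injOn_map : Set.InjOn T.map T.ref.cell := T.injOn

lemma inv_map {z : Plane} (hz : z ∈ T.ref.cell) : T.inv (T.map z) = z :=
  T.injOn_map.leftInvOn_invFunOn hz

lemma map_inv {x : Plane} (hx : x ∈ T.carrier) : T.map (T.inv x) = x :=
  Function.invFunOn_eq hx

lemma inv_mem {x : Plane} (hx : x ∈ T.carrier) : T.inv x ∈ T.ref.cell :=
  Function.invFunOn_mem hx

lemma isCompact_carrier : IsCompact T.carrier := T.ref.isCompact_cell.image T.continuous_map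

lemma openCell_subset_carrier : T.openCell ⊆ T.carrier := Set.image_mono interior_subset

lemma continuousOn_inv : ContinuousOn T.inv T.carrier := by
  rw [continuousOn_iff_isClosed]
  intro t ht
  refine ⟨T.map '' (T.ref.cell ∩ t),
    ((T.ref.isCompact_cell.inter_right ht).image T.continuous_map).isClosed, ?_⟩
  ext x
  constructor
  · rintro ⟨hxt, hx⟩
    exact ⟨⟨T.inv x, ⟨T.inv_mem hx, hxt⟩, T.map_inv hx⟩, hx⟩
  · rintro ⟨⟨z, ⟨hz, hzt⟩, rfl⟩, hx⟩
    exact ⟨by rwa [Set.mem_preimage, T.inv_map hz], hx⟩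

lemma isOpen_openCell : IsOpen T.openCell := by
  rw [isOpen_iff_mem_nhds]
  rintro _ ⟨z, hz, rfl⟩
  obtain ⟨L, hL⟩ := T.exists_continuousLinearEquiv_fderiv_map (interior_subset hz)
  have h := T.hasStrictFDerivAt_map z
  rw [← hL] at h
  rw [← h.map_nhds_eq_of_equiv]
  exact image_mem_map (isOpen_interior.mem_nhds hz)

lemma carrier_subset_closure_openCell : T.carrier ⊆ closure T.openCell := by
  rw [carrier, ← T.ref.closure_interior_cell]
  exact image_closure_subset_closure_image T.continuous_map

lemma volume_image_eq_zero {s : Set Plane} (hs : volume s = 0) : volume (T.map '' s) = 0 :=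
  addHaar_image_eq_zero_of_differentiableOn_of_addHaar_eq_zero volume
    ((T.contDiff_map (n := 1)).differentiable one_ne_zero).differentiableOn hs

lemma openCell_ae_eq_carrier : T.openCell =ᵐ[volume] T.carrier := by
  refine EventuallyLE.antisymm (ae_of_all _ T.openCell_subset_carrier) (ae_le_set.2 ?_)
  refine measure_mono_null ?_ (T.volume_image_eq_zero
    (T.ref.convex_cell.addHaar_frontier volume))
  rintro _ ⟨⟨z, hz, rfl⟩, hzT⟩
  exact ⟨z, ⟨subset_closure hz, fun h => hzT ⟨z, h, rfl⟩⟩, rfl⟩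

lemma edge_subset_carrier (a : Fin T.ref.numVertices) : T.edge a ⊆ T.carrier :=
  Set.image_mono (T.ref.edge_subset_cell a)

lemma isCompact_edge (a : Fin T.ref.numVertices) : IsCompact (T.edge a) :=
  (T.ref.isCompact_edge a).image T.continuous_map

lemma volume_edge (a : Fin T.ref.numVertices) : volume (T.edge a) = 0 :=
  T.volume_image_eq_zero (T.ref.volume_edge a)

lemma diam_edge_le_diam (a : Fin T.ref.numVertices) : Metric.diam (T.edge a) ≤ T.diam :=
  Metric.diam_mono (T.edge_subset_carrier a) T.isCompact_carrier.isBounded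

lemma diam_edge_pos (a : Fin T.ref.numVertices) : 0 < Metric.diam (T.edge a) := by
  have hleft : T.ref.vertex a ∈ T.ref.edge a := left_mem_segment ℝ _ _
  have hright : T.ref.vertex (finRotate _ a) ∈ T.ref.edge a := right_mem_segment ℝ _ _
  have hne := (T.injOn_map.mono (T.ref.edge_subset_cell a)).ne hleft hright
    (T.ref.vertex_ne_vertex_finRotate a)
  exact (dist_pos.2 hne).trans_le (Metric.dist_le_diam_of_mem (T.isCompact_edge a).isBounded
    ⟨_, hleft, rfl⟩ ⟨_, hright, rfl⟩)

lemma diam_pos : 0 < T.diam :=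
  have : NeZero T.ref.numVertices := ⟨by cases T.ref <;> decide⟩
  (T.diam_edge_pos 0).trans_le (T.diam_edge_le_diam 0)

/-- `w` is, inside `T`, the pushforward of a function smooth up to the boundary of the reference
cell. Unlike the polynomials on the reference cell, this class is stable under `grad`. -/
def SmoothUpTo (w : Plane → ℝ) : Prop :=
  ∃ q : Plane → ℝ, (∀ z ∈ T.ref.cell, ContDiffAt ℝ (⊤ : ℕ∞) q z) ∧
    ∀ z ∈ interior T.ref.cell, w (T.map z) = q z

variable {T}

lemma smoothUpTo_of_polyEval {w : Plane → ℝ} {p : MvPolynomial (Fin 2) ℝ}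
    (h : ∀ z ∈ interior T.ref.cell, w (T.map z) = polyEval p z) : T.SmoothUpTo w :=
  ⟨polyEval p, fun _ _ => (contDiff_polyEval p).contDiffAt, h⟩

lemma hasFDerivAt_inv {z : Plane} (hz : z ∈ interior T.ref.cell) :
    HasFDerivAt T.inv (fderiv ℝ T.map z).inverse (T.map z) := by
  obtain ⟨L, hL⟩ := T.exists_continuousLinearEquiv_fderiv_map (interior_subset hz)
  have hmap := T.hasStrictFDerivAt_map z
  rw [← hL] at hmap ⊢
  rw [ContinuousLinearMap.inverse_equiv]
  have hnhds : ∀ᶠ y in 𝓝 z, y ∈ interior T.ref.cell := isOpen_interior.mem_nhds hz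
  exact (hmap.to_local_left_inverse
    (hnhds.mono fun y hy => T.inv_map (interior_subset hy))).hasFDerivAt

lemma SmoothUpTo.grad {w : Plane → ℝ} (h : T.SmoothUpTo w) (j : Fin 2) :
    T.SmoothUpTo fun x => grad w x j := by
  obtain ⟨q, hq, hw⟩ := h
  refine ⟨fun z => fderiv ℝ q z ((fderiv ℝ T.map z).inverse (EuclideanSpace.single j 1)),
    fun z hz => ?_, fun z hz => ?_⟩
  · obtain ⟨L, hL⟩ := T.exists_continuousLinearEquiv_fderiv_map hz
    have hinv : ContDiffAt ℝ (⊤ : ℕ∞) ContinuousLinearMap.inverse (fderiv ℝ T.map z) := by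
      rw [← hL]; exact contDiffAt_map_inverse L
    exact ((hq z hz).fderiv_right (by simp)).clm_apply
      ((hinv.comp z (T.contDiff_map.contDiffAt.fderiv_right (n := (⊤ : ℕ∞)) (by simp))).clm_apply
        contDiffAt_const)
  · have hqz : HasFDerivAt q (fderiv ℝ q z) (T.inv (T.map z)) := by
      rw [T.inv_map (interior_subset hz)]
      exact ((hq z (interior_subset hz)).differentiableAt (by simp)).hasFDerivAt
    have heq : w =ᶠ[𝓝 (T.map z)] q ∘ T.inv := by
      filter_upwards [T.isOpen_openCell.mem_nhds ⟨z, hz, rfl⟩]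
      rintro _ ⟨y, hy, rfl⟩
      rw [Function.comp_apply, T.inv_map (interior_subset hy), hw y hy]
    simp only [PrestrainedPlate.grad]
    rw [((hqz.comp (T.map z) (hasFDerivAt_inv hz)).congr_of_eventuallyEq heq).fderiv]
    rfl

lemma eqOn_traceFrom_comp_inv {w q : Plane → ℝ} (hq : ContinuousOn q T.ref.cell)
    (hw : ∀ z ∈ interior T.ref.cell, w (T.map z) = q z) :
    Set.EqOn (traceFrom T.openCell w) (q ∘ T.inv) T.carrier := by
  refine eqOn_traceFrom T.openCell_subset_carrier T.carrier_subset_closure_openCell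
    (hq.comp T.continuousOn_inv fun x hx => T.inv_mem hx) ?_
  rintro _ ⟨z, hz, rfl⟩
  rw [Function.comp_apply, T.inv_map (interior_subset hz), hw z hz]

lemma traceFrom_map {w q : Plane → ℝ} (hq : ContinuousOn q T.ref.cell)
    (hw : ∀ z ∈ interior T.ref.cell, w (T.map z) = q z) {z : Plane} (hz : z ∈ T.ref.cell) :
    traceFrom T.openCell w (T.map z) = q z := by
  rw [eqOn_traceFrom_comp_inv hq hw ⟨z, hz, rfl⟩, Function.comp_apply, T.inv_map hz]

lemma SmoothUpTo.continuousOn_traceFrom {w : Plane → ℝ} (h : T.SmoothUpTo w) :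
    ContinuousOn (traceFrom T.openCell w) T.carrier := by
  obtain ⟨q, hq, hw⟩ := h
  have hqc : ContinuousOn q T.ref.cell := fun z hz => (hq z hz).continuousAt.continuousWithinAt
  exact (hqc.comp T.continuousOn_inv fun x hx => T.inv_mem hx).congr
    (eqOn_traceFrom_comp_inv hqc hw)

lemma SmoothUpTo.eqOn_traceFrom {w : Plane → ℝ} (h : T.SmoothUpTo w) :
    Set.EqOn (traceFrom T.openCell w) w T.openCell := by
  obtain ⟨q, hq, hw⟩ := h
  rintro _ ⟨z, hz, rfl⟩
  rw [traceFrom_map (fun z hz => (hq z hz).continuousAt.continuousWithinAt) hw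
    (interior_subset hz), hw z hz]

lemma SmoothUpTo.memLp_top {w : Plane → ℝ} (h : T.SmoothUpTo w) :
    MemLp w ⊤ (volume.restrict T.carrier) := by
  have hcont := h.continuousOn_traceFrom
  obtain ⟨C, hC⟩ := T.isCompact_carrier.exists_bound_of_continuousOn hcont
  have hmeas := T.isCompact_carrier.measurableSet
  have htrace : MemLp (traceFrom T.openCell w) ⊤ (volume.restrict T.carrier) :=
    memLp_top_of_bound (hcont.aestronglyMeasurable hmeas) C
      ((ae_restrict_iff' hmeas).2 (ae_of_all _ hC))
  refine htrace.ae_eq ?_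
  rw [← Measure.restrict_congr_set T.openCell_ae_eq_carrier]
  exact ae_restrict_of_forall_mem T.isOpen_openCell.measurableSet h.eqOn_traceFrom

end IsoElement

lemma exists_norm_sq_le_mul_integral_sq {X : Type*} [TopologicalSpace X] [CompactSpace X]
    [MeasurableSpace X] [BorelSpace X] (ν : Measure X) [IsFiniteMeasure ν] [ν.IsOpenPosMeasure]
    (U : Submodule ℝ C(X, ℝ)) [FiniteDimensional ℝ U] :
    ∃ C : ℝ, 0 < C ∧ ∀ f ∈ U, ‖f‖ ^ 2 ≤ C * ∫ x, f x ^ 2 ∂ν := by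
  let toL2 : U →ₗ[ℝ] Lp ℝ 2 ν := (ContinuousMap.toLp 2 ν ℝ).toLinearMap ∘ₗ U.subtype
  have hinj : toL2.ker = ⊥ := LinearMap.ker_eq_bot.2
    ((ContinuousMap.toLp_injective (p := 2) (𝕜 := ℝ) ν).comp U.injective_subtype)
  obtain ⟨K, hK, hanti⟩ :=
    LinearMap.exists_antilipschitzWith (𝕜 := ℝ) (E := U) (F := Lp ℝ 2 ν) toL2 hinj
  refine ⟨(K : ℝ) ^ 2, by positivity, fun f hf => ?_⟩
  have hnorm : ‖f‖ ≤ K * ‖toL2 ⟨f, hf⟩‖ := by simpa using hanti.le_mul_dist ⟨f, hf⟩ 0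
  have hL2 : ‖toL2 ⟨f, hf⟩‖ ^ 2 = ∫ x, f x ^ 2 ∂ν := by
    rw [← real_inner_self_eq_norm_sq]
    change inner ℝ (ContinuousMap.toLp 2 ν ℝ f) (ContinuousMap.toLp 2 ν ℝ f) = _
    rw [ContinuousMap.inner_toLp]
    simp only [conj_trivial, pow_two]
  rw [← hL2, ← mul_pow]
  exact pow_le_pow_left₀ (norm_nonneg f) hnorm 2

lemma isOpenPosMeasure_comap_subtype_val {X : Type*} [TopologicalSpace X] [MeasurableSpace X]
    (μ : Measure X) [μ.IsOpenPosMeasure] {s : Set X} (hs : MeasurableSet s)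
    (hsi : s ⊆ closure (interior s)) :
    (μ.comap (Subtype.val : s → X)).IsOpenPosMeasure := by
  refine ⟨fun U hU ⟨x, hx⟩ hzero => ?_⟩
  obtain ⟨V, hV, rfl⟩ := isOpen_induced_iff.1 hU
  rw [(MeasurableEmbedding.subtype_coe hs).comap_apply] at hzero
  have hne : (V ∩ interior s).Nonempty := mem_closure_iff.1 (hsi x.2) V hV hx
  refine ((hV.inter isOpen_interior).measure_pos μ hne).ne' (measure_mono_null ?_ hzero)
  rintro y ⟨hyV, hyi⟩
  exact ⟨⟨y, interior_subset hyi⟩, hyV, rfl⟩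

namespace RefCell

variable (s : RefCell)

/-- Restriction of polynomials to the reference cell, as a linear map into the continuous
functions; it makes the compactness argument behind the inverse estimate available. -/
def evalOnCell : MvPolynomial (Fin 2) ℝ →ₗ[ℝ] C(s.cell, ℝ) where
  toFun p := ⟨fun z => polyEval p z, (continuous_polyEval p).comp continuous_subtype_val⟩
  map_add' p q := by ext z; simp [polyEval]
  map_smul' c p := by ext z; simp [polyEval]

instance finiteDimensional_polySpace (l : ℕ) : FiniteDimensional ℝ (s.polySpace l) := by
  cases s
  · exact inferInstanceAs (FiniteDimensional ℝ (MvPolynomial.restrictTotalDegree (Fin 2) ℝ l))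
  · exact inferInstanceAs (FiniteDimensional ℝ (MvPolynomial.restrictDegree (Fin 2) ℝ l))

lemma exists_polyEval_sq_le_mul_setIntegral (l : ℕ) : ∃ C : ℝ, 0 < C ∧
    ∀ p ∈ s.polySpace l, ∀ z ∈ s.cell, polyEval p z ^ 2 ≤ C * ∫ x in s.cell, polyEval p x ^ 2 := by
  have : CompactSpace s.cell := isCompact_iff_compactSpace.1 s.isCompact_cell
  have hmeas : MeasurableSet s.cell := s.isCompact_cell.measurableSet
  have := isOpenPosMeasure_comap_subtype_val volume hmeas s.closure_interior_cell.ge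
  have : IsFiniteMeasureOnCompacts (volume.comap (Subtype.val : s.cell → Plane)) :=
    .comap' volume continuous_subtype_val (.subtype_coe hmeas)
  obtain ⟨C, hC, hbound⟩ := exists_norm_sq_le_mul_integral_sq
    (volume.comap (Subtype.val : s.cell → Plane)) ((s.polySpace l).map s.evalOnCell)
  refine ⟨C, hC, fun p hp z hz => ?_⟩
  calc polyEval p z ^ 2 = |polyEval p z| ^ 2 := (sq_abs _).symm
    _ ≤ ‖s.evalOnCell p‖ ^ 2 :=
        pow_le_pow_left₀ (abs_nonneg _) ((s.evalOnCell p).norm_coe_le_norm ⟨z, hz⟩) 2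
    _ ≤ C * ∫ x, s.evalOnCell p x ^ 2 ∂_ := hbound _ ⟨p, hp, rfl⟩
    _ = C * ∫ x in s.cell, polyEval p x ^ 2 := by rw [← integral_subtype_comap hmeas]; rfl

end RefCell

namespace IsoElement

variable {k : ℕ} {T : IsoElement k} {σ : ℝ}

variable (T) in
/-- The two inequalities of `ShapeRegular` for the single element `T`, with constant `σ`. -/
def ShapeBound (σ : ℝ) : Prop :=
  ∀ z ∈ T.ref.cell, frobNorm (T.jacobian z) ≤ σ * T.diam ∧
    frobNorm (T.jacobian z)⁻¹ ≤ σ * T.diam⁻¹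

lemma ShapeBound.diam_sq_le_mul_abs_det (h : T.ShapeBound σ) {z : Plane} (hz : z ∈ T.ref.cell) :
    T.diam ^ 2 ≤ σ ^ 2 * |(T.jacobian z).det| := by
  have hdiam := T.diam_pos
  have hdet : 0 < |(T.jacobian z).det| := abs_pos.2 (T.det_ne_zero z hz)
  have hinv : |(T.jacobian z).det|⁻¹ ≤ (σ * T.diam⁻¹) ^ 2 := by
    have hle := abs_det_fin_two_le_frobSq (T.jacobian z)⁻¹
    rw [Matrix.det_nonsing_inv, Ring.inverse_eq_inv', abs_inv, ← frobNorm_sq] at hle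
    exact hle.trans (pow_le_pow_left₀ (frobNorm_nonneg _) (h z hz).2 2)
  rwa [mul_pow, inv_pow, ← div_eq_mul_inv, inv_le_iff_one_le_mul₀ hdet, div_mul_eq_mul_div,
    one_le_div (by positivity)] at hinv

lemma ShapeBound.pos (h : T.ShapeBound σ) : 0 < σ := by
  obtain ⟨z, hz⟩ := T.ref.cell_nonempty
  have hsq : 0 < σ ^ 2 * |(T.jacobian z).det| :=
    (pow_pos T.diam_pos 2).trans_le (h.diam_sq_le_mul_abs_det hz)
  have hσ : 0 ≤ σ :=
    nonneg_of_mul_nonneg_left ((frobNorm_nonneg _).trans (h z hz).1) T.diam_pos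
  exact hσ.lt_of_ne fun h0 => by simp [← h0] at hsq

lemma setIntegral_carrier (w : Plane → ℝ) :
    ∫ x in T.carrier, w x = ∫ z in T.ref.cell, |(T.jacobian z).det| * w (T.map z) := by
  rw [carrier, integral_image_eq_integral_abs_det_fderiv_smul volume
    T.ref.isCompact_cell.measurableSet
    (fun z _ => (T.hasStrictFDerivAt_map z).hasFDerivAt.hasFDerivWithinAt) T.injOn_map]
  simp only [det_fderiv_map, smul_eq_mul]

lemma continuous_det_jacobian : Continuous fun z => (T.jacobian z).det := by
  simp only [← det_fderiv_map]
  exact ContinuousLinearMap.continuous_det.comp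
    ((T.contDiff_map (n := 1)).continuous_fderiv one_ne_zero)

lemma ShapeBound.diam_sq_mul_setIntegral_cell_le (h : T.ShapeBound σ) {f w : Plane → ℝ}
    (hf : Continuous f) (hf0 : 0 ≤ f) (hw : ∀ z ∈ interior T.ref.cell, w (T.map z) = f z) :
    T.diam ^ 2 * ∫ z in T.ref.cell, f z ≤ σ ^ 2 * ∫ x in T.carrier, w x := by
  have hint : ∀ F : Plane → ℝ, Continuous F → IntegrableOn F T.ref.cell :=
    fun F hF => hF.continuousOn.integrableOn_compact T.ref.isCompact_cell
  have hcell : interior T.ref.cell =ᵐ[volume] T.ref.cell :=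
    interior_ae_eq_of_null_frontier (T.ref.convex_cell.addHaar_frontier volume)
  have hwf : ∫ x in T.carrier, w x = ∫ z in T.ref.cell, |(T.jacobian z).det| * f z := by
    rw [setIntegral_carrier]
    refine (setIntegral_congr_set hcell).symm.trans
      ((setIntegral_congr_fun isOpen_interior.measurableSet fun z hz => ?_).trans
        (setIntegral_congr_set hcell))
    simp only [hw z hz]
  rw [hwf, ← integral_const_mul, ← integral_const_mul]
  refine setIntegral_mono_on (hint _ (by fun_prop))
    (hint _ (((continuous_det_jacobian (T := T)).abs.mul hf).const_mul _))
    T.ref.isCompact_cell.measurableSet fun z hz => ?_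
  rw [← mul_assoc]
  exact mul_le_mul_of_nonneg_right (h.diam_sq_le_mul_abs_det hz) (hf0 z)

lemma ShapeBound.diam_sq_mul_volume_cell_le (h : T.ShapeBound σ) :
    T.diam ^ 2 * volume.real T.ref.cell ≤ σ ^ 2 * volume.real T.carrier := by
  simpa using h.diam_sq_mul_setIntegral_cell_le (f := 1) (w := 1) continuous_const
    zero_le_one fun _ _ => rfl

lemma ShapeBound.traceFrom_sq_le (h : T.ShapeBound σ) {C : ℝ} (hC : 0 ≤ C)
    {p : MvPolynomial (Fin 2) ℝ}
    (hp : ∀ z ∈ T.ref.cell, polyEval p z ^ 2 ≤ C * ∫ z in T.ref.cell, polyEval p z ^ 2)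
    {w : Plane → ℝ} (hw : ∀ z ∈ interior T.ref.cell, w (T.map z) = polyEval p z)
    {x : Plane} (hx : x ∈ T.carrier) :
    traceFrom T.openCell w x ^ 2 ≤ C * σ ^ 2 * (T.diam ^ 2)⁻¹ * ∫ x in T.carrier, w x ^ 2 := by
  have hdiam := T.diam_pos
  have hscale := h.diam_sq_mul_setIntegral_cell_le (f := fun z => polyEval p z ^ 2)
    (w := fun x => w x ^ 2) ((continuous_polyEval p).pow 2) (fun z => sq_nonneg _)
    fun z hz => by rw [hw z hz]
  rw [eqOn_traceFrom_comp_inv (continuous_polyEval p).continuousOn hw hx]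
  calc polyEval p (T.inv x) ^ 2 ≤ C * ∫ z in T.ref.cell, polyEval p z ^ 2 :=
        hp _ (T.inv_mem hx)
    _ = C * (T.diam ^ 2)⁻¹ * (T.diam ^ 2 * ∫ z in T.ref.cell, polyEval p z ^ 2) := by
        field_simp
    _ ≤ C * (T.diam ^ 2)⁻¹ * (σ ^ 2 * ∫ x in T.carrier, w x ^ 2) := by gcongr
    _ = C * σ ^ 2 * (T.diam ^ 2)⁻¹ * ∫ x in T.carrier, w x ^ 2 := by ring

lemma hausdorffMeasure_edge_le_of_norm_fderiv_le {B : ℝ}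
    (hB : ∀ z ∈ T.ref.cell, ‖fderiv ℝ T.map z‖ ≤ B) (a : Fin T.ref.numVertices) :
    μH[1] (T.edge a) ≤ ENNReal.ofReal (2 * B) := by
  have hlip : LipschitzOnWith (Real.toNNReal B) T.map (T.ref.edge a) :=
    (T.ref.convex_cell.lipschitzOnWith_of_nnnorm_hasFDerivWithin_le
      (fun z _ => (T.hasStrictFDerivAt_map z).hasFDerivAt.hasFDerivWithinAt)
      fun z hz => NNReal.le_toNNReal_of_coe_le (hB z hz)).mono (T.ref.edge_subset_cell a)
  refine (hlip.hausdorffMeasure_image_le zero_le_one).trans ?_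
  rw [RefCell.edge, hausdorffMeasure_segment, ENNReal.rpow_one, edist_dist, mul_comm 2 B,
    ENNReal.ofReal_mul' zero_le_two]
  exact mul_le_mul' le_rfl (ENNReal.ofReal_le_ofReal (T.ref.dist_vertex_le _ _))

lemma hausdorffMeasure_edge_lt_top (a : Fin T.ref.numVertices) : μH[1] (T.edge a) < ⊤ := by
  obtain ⟨B, hB⟩ := T.ref.isCompact_cell.exists_bound_of_continuousOn
    (f := fderiv ℝ T.map) ((T.contDiff_map (n := 1)).continuous_fderiv one_ne_zero).continuousOn
  exact (hausdorffMeasure_edge_le_of_norm_fderiv_le hB a).trans_lt ENNReal.ofReal_lt_top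

lemma ShapeBound.hausdorffMeasure_edge_le (h : T.ShapeBound σ) (a : Fin T.ref.numVertices) :
    μH[1] (T.edge a) ≤ ENNReal.ofReal (2 * (σ * T.diam)) :=
  hausdorffMeasure_edge_le_of_norm_fderiv_le (fun z hz => by
    rw [fderiv_map]; exact (norm_toEuclideanCLM_le _).trans (h z hz).1) a

end IsoElement

lemma memLp_top_restrict_iUnion {α ι : Type*} [MeasurableSpace α] {ν : Measure α} [Finite ι]
    {s : ι → Set α} {f : α → ℝ} (hf : ∀ i, MemLp f ⊤ (ν.restrict (s i))) :
    MemLp f ⊤ (ν.restrict (⋃ i, s i)) := by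
  have := Fintype.ofFinite ι
  refine ⟨aestronglyMeasurable_iUnion_iff.2 fun i => (hf i).1, ?_⟩
  rw [eLpNorm_exponent_top]
  refine (essSup_le_of_ae_le (∑ i, eLpNormEssSup f (ν.restrict (s i))) ?_).trans_lt
    (ENNReal.sum_lt_top.2 fun i _ => by simpa using (hf i).2)
  refine (ae_restrict_iUnion_iff _ _).2 fun i => ?_
  filter_upwards [ae_le_eLpNormEssSup (f := f)] with x hx
  exact hx.trans (Finset.single_le_sum (f := fun i => eLpNormEssSup f (ν.restrict (s i)))
    (fun _ _ => zero_le) (Finset.mem_univ i))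

/-- The entries of the matrix field `A` belong to `L^∞(ν)`. Stated entrywise because matrices
carry no canonical norm. -/
def IsBoundedField {α : Type*} [MeasurableSpace α] {m n : ℕ} (ν : Measure α)
    (A : α → Matrix (Fin m) (Fin n) ℝ) : Prop :=
  ∀ i j, MemLp (fun x => A x i j) ⊤ ν

namespace IsBoundedField

variable {α : Type*} [MeasurableSpace α] {ν : Measure α} {m n p : ℕ}
  {A B : α → Matrix (Fin m) (Fin n) ℝ}

lemma sub (hA : IsBoundedField ν A) (hB : IsBoundedField ν B) :
    IsBoundedField ν fun x => A x - B x := fun i j => (hA i j).sub (hB i j)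

lemma sum {ι : Type*} {s : Finset ι} {A : ι → α → Matrix (Fin m) (Fin n) ℝ}
    (hA : ∀ e ∈ s, IsBoundedField ν (A e)) : IsBoundedField ν fun x => ∑ e ∈ s, A e x :=
  fun i j => by simpa only [Matrix.sum_apply] using memLp_finsetSum s fun e he => hA e he i j

lemma transpose (hA : IsBoundedField ν A) : IsBoundedField ν fun x => (A x).transpose :=
  fun i j => hA j i

lemma mul {B : α → Matrix (Fin n) (Fin p) ℝ} (hA : IsBoundedField ν A)
    (hB : IsBoundedField ν B) : IsBoundedField ν fun x => A x * B x := fun i j => by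
  simp only [Matrix.mul_apply]
  exact memLp_finsetSum _ fun k _ => (hB k j).mul' (hA i k)

lemma memLp_frobSq (hA : IsBoundedField ν A) : MemLp (fun x => frobSq (A x)) ⊤ ν :=
  memLp_finsetSum _ fun i _ => memLp_finsetSum _ fun j _ => by
    simpa only [pow_two] using (hA i j).mul' (hA i j)

lemma memLp_frobNorm (hA : IsBoundedField ν A) : MemLp (fun x => frobNorm (A x)) ⊤ ν := by
  refine ((memLp_top_const (1 : ℝ)).add hA.memLp_frobSq).mono
    (Real.continuous_sqrt.comp_aestronglyMeasurable hA.memLp_frobSq.1) (ae_of_all _ fun x => ?_)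
  have hnonneg := frobSq_nonneg (A x)
  rw [Pi.add_apply, Real.norm_of_nonneg (frobNorm_nonneg _), Real.norm_of_nonneg (by positivity),
    frobNorm, Real.sqrt_le_left (by positivity)]
  nlinarith

lemma memLp_trace_sq {A : α → Matrix (Fin n) (Fin n) ℝ} (hA : IsBoundedField ν A) :
    MemLp (fun x => (A x).trace ^ 2) ⊤ ν := by
  have htrace : MemLp (fun x => (A x).trace) ⊤ ν := memLp_finsetSum _ fun i _ => hA i i
  simpa only [pow_two] using htrace.mul' htrace

end IsBoundedField

lemma dotProduct_self_nonneg {n : Type*} [Fintype n] (v : n → ℝ) : 0 ≤ v ⬝ᵥ v := by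
  simpa using dotProduct_star_self_nonneg v

lemma IsoElement.unitNormal_dotProduct_self_le_one {k : ℕ} (T : IsoElement k)
    (a : Fin T.ref.numVertices) (x : Plane) : T.unitNormal a x ⬝ᵥ T.unitNormal a x ≤ 1 := by
  simp only [IsoElement.unitNormal]
  generalize ((T.jacobian (T.inv x))⁻¹).transpose.mulVec (T.ref.normal a) = w
  rw [smul_dotProduct, dotProduct_smul, smul_eq_mul, smul_eq_mul, ← mul_assoc, ← mul_inv,
    Real.mul_self_sqrt (dotProduct_self_nonneg w)]
  exact inv_mul_le_one

lemma RefCell.exists_pos_le_volume_cell :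
    ∃ c : ℝ, 0 < c ∧ ∀ s : RefCell, c ≤ volume.real s.cell := by
  have hpos (s : RefCell) : 0 < volume.real s.cell :=
    ENNReal.toReal_pos
      (Measure.measure_pos_of_nonempty_interior volume s.nonempty_interior_cell).ne'
      s.isCompact_cell.measure_lt_top.ne
  refine ⟨min (volume.real triangle.cell) (volume.real quadrilateral.cell),
    lt_min (hpos _) (hpos _), fun s => ?_⟩
  cases s
  exacts [min_le_left _ _, min_le_right _ _]

namespace IsoMesh

variable {k : ℕ} {Ω : Set Plane} {M : IsoMesh k Ω}

lemma smoothUpTo_of_mem_femSpace {v : Plane → ℝ} (hv : v ∈ M.femSpace) (i : Fin M.N) :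
    (M.elem i).SmoothUpTo v := by
  obtain ⟨p, -, hp⟩ := hv.2 i
  exact (M.elem i).smoothUpTo_of_polyEval fun z hz => hp z (interior_subset hz)

lemma smoothUpTo_of_mem_brokenSpace {l : ℕ} {w : Plane → ℝ} (hw : w ∈ M.brokenSpace l)
    (i : Fin M.N) : (M.elem i).SmoothUpTo w := by
  obtain ⟨p, -, hp⟩ := hw i
  exact (M.elem i).smoothUpTo_of_polyEval hp

variable (M) in
lemma subset_iUnion_carrier : Ω ⊆ ⋃ i, (M.elem i).carrier := M.cover ▸ subset_closure

lemma memLp_top_of_smoothUpTo {w : Plane → ℝ} (h : ∀ i, (M.elem i).SmoothUpTo w) :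
    MemLp w ⊤ (volume.restrict Ω) :=
  (memLp_top_restrict_iUnion fun i => (h i).memLp_top).mono_measure
    (Measure.restrict_mono_set _ M.subset_iUnion_carrier)

variable (M) in
lemma volume_inter_carrier {i j : Fin M.N} (hij : i ≠ j) :
    volume ((M.elem i).carrier ∩ (M.elem j).carrier) = 0 := by
  rcases M.conforming i j hij with h | ⟨a, b, h, -⟩ | ⟨a, b, h, -⟩
  · rw [h, measure_empty]
  · rw [h, measure_singleton]
  · rw [h]; exact (M.elem i).volume_edge a

variable (M) in
lemma ae_existsUnique_mem_carrier :
    ∀ᵐ x ∂(volume.restrict Ω), ∃! m, x ∈ (M.elem m).carrier := by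
  have hmem : ∀ᵐ x ∂(volume.restrict Ω), x ∈ closure Ω :=
    ae_mono (Measure.restrict_mono_set volume subset_closure)
      (ae_restrict_mem isClosed_closure.measurableSet)
  have hnot : ∀ᵐ x : Plane, ∀ i j, i ≠ j → x ∉ (M.elem i).carrier ∩ (M.elem j).carrier := by
    simp only [ae_all_iff]
    exact fun i j hij => measure_eq_zero_iff_ae_notMem.1 (M.volume_inter_carrier hij)
  filter_upwards [hmem, ae_restrict_of_ae hnot] with x hx hdisj
  obtain ⟨m, hm⟩ := Set.mem_iUnion.1 (M.cover.symm ▸ hx)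
  exact ⟨m, hm, fun i hi => by_contra fun hne => hdisj i m hne ⟨hi, hm⟩⟩

lemma isFiniteMeasure_restrict (M : IsoMesh k Ω) : IsFiniteMeasure (volume.restrict Ω) := by
  refine ⟨?_⟩
  rw [Measure.restrict_apply_univ]
  exact (measure_mono M.subset_iUnion_carrier).trans_lt
    (isCompact_iUnion fun i => (M.elem i).isCompact_carrier).measure_lt_top

variable (M) in
/-- Shape regularity and quasi-uniformity of a single mesh, with explicit constants. -/
structure Regular (σ τ : ℝ) : Prop where
  shape : ∀ i, (M.elem i).ShapeBound σ
  quasi : ∀ i j, (M.elem i).diam ≤ τ * (M.elem j).diam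

variable (M) in
open Classical in
/-- The elements that meet a given element, itself included: the patch whose size governs the
overlap of the local liftings. -/
def neighbours (i : Fin M.N) : Finset (Fin M.N) :=
  Finset.univ.filter fun j => ((M.elem i).carrier ∩ (M.elem j).carrier).Nonempty

lemma mem_neighbours {i j : Fin M.N} :
    j ∈ M.neighbours i ↔ ((M.elem i).carrier ∩ (M.elem j).carrier).Nonempty := by
  simp [neighbours]

variable {σ τ : ℝ}

lemma Regular.carrier_subset_closedBall (h : M.Regular σ τ) {i j : Fin M.N}
    (hj : j ∈ M.neighbours i) {x₀ : Plane} (hx₀ : x₀ ∈ (M.elem i).carrier) :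
    (M.elem j).carrier ⊆ Metric.closedBall x₀ ((1 + τ) * (M.elem i).diam) := by
  obtain ⟨y, hyi, hyj⟩ := mem_neighbours.1 hj
  intro x hx
  calc dist x x₀ ≤ dist x y + dist y x₀ := dist_triangle _ _ _
    _ ≤ (M.elem j).diam + (M.elem i).diam :=
      add_le_add (Metric.dist_le_diam_of_mem (M.elem j).isCompact_carrier.isBounded hx hyj)
        (Metric.dist_le_diam_of_mem (M.elem i).isCompact_carrier.isBounded hyi hx₀)
    _ ≤ (1 + τ) * (M.elem i).diam := by linarith [h.quasi j i]

lemma Regular.diam_sq_mul_le_volume_carrier (h : M.Regular σ τ) {c : ℝ}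
    (hc : ∀ s : RefCell, c ≤ volume.real s.cell) (i j : Fin M.N) :
    (M.elem i).diam ^ 2 * c ≤ (τ * σ) ^ 2 * volume.real (M.elem j).carrier :=
  calc (M.elem i).diam ^ 2 * c
      ≤ (τ * (M.elem j).diam) ^ 2 * volume.real (M.elem j).ref.cell :=
        (mul_le_mul_of_nonneg_left (hc _) (by positivity)).trans
          (mul_le_mul_of_nonneg_right
            (pow_le_pow_left₀ (M.elem i).diam_pos.le (h.quasi i j) 2) measureReal_nonneg)
    _ = τ ^ 2 * ((M.elem j).diam ^ 2 * volume.real (M.elem j).ref.cell) := by ring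
    _ ≤ τ ^ 2 * (σ ^ 2 * volume.real (M.elem j).carrier) :=
        mul_le_mul_of_nonneg_left (h.shape j).diam_sq_mul_volume_cell_le (sq_nonneg τ)
    _ = (τ * σ) ^ 2 * volume.real (M.elem j).carrier := by ring

variable (M) in
lemma sum_volume_carrier_le {s : Finset (Fin M.N)} {x₀ : Plane} {r : ℝ} (hr : 0 ≤ r)
    (hs : ∀ j ∈ s, (M.elem j).carrier ⊆ Metric.closedBall x₀ r) :
    ∑ j ∈ s, volume.real (M.elem j).carrier ≤ Real.pi * r ^ 2 := by
  have hball : volume.real (Metric.closedBall x₀ r) = Real.pi * r ^ 2 := by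
    rw [Measure.real, EuclideanSpace.volume_closedBall_fin_two, ENNReal.toReal_mul,
      ENNReal.toReal_pow, ENNReal.toReal_ofReal hr, ENNReal.toReal_ofReal Real.pi_pos.le, mul_comm]
  rw [← hball, ← measureReal_biUnion_finset₀ (fun i _ j _ hij => M.volume_inter_carrier hij)
    (fun j _ => (M.elem j).isCompact_carrier.measurableSet.nullMeasurableSet)
    (fun j _ => (M.elem j).isCompact_carrier.measure_lt_top.ne)]
  exact measureReal_mono (Set.iUnion₂_subset hs) measure_closedBall_lt_top.ne

lemma Regular.card_neighbours_mul_le (h : M.Regular σ τ) {c : ℝ}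
    (hc : ∀ s : RefCell, c ≤ volume.real s.cell) (i : Fin M.N) :
    (M.neighbours i).card * c ≤ (τ * σ) ^ 2 * (Real.pi * (1 + τ) ^ 2) := by
  have hd := (M.elem i).diam_pos
  obtain ⟨x₀, hx₀⟩ : (M.elem i).carrier.Nonempty := (RefCell.cell_nonempty _).image _
  refine le_of_mul_le_mul_left ?_ (pow_pos hd 2)
  calc (M.elem i).diam ^ 2 * ((M.neighbours i).card * c)
      = ∑ _j ∈ M.neighbours i, (M.elem i).diam ^ 2 * c := by
        rw [Finset.sum_const, nsmul_eq_mul]; ring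
    _ ≤ (τ * σ) ^ 2 * ∑ j ∈ M.neighbours i, volume.real (M.elem j).carrier := by
        rw [Finset.mul_sum]
        exact Finset.sum_le_sum fun j _ => h.diam_sq_mul_le_volume_carrier hc i j
    _ ≤ (τ * σ) ^ 2 * (Real.pi * ((1 + τ) * (M.elem i).diam) ^ 2) :=
        mul_le_mul_of_nonneg_left (M.sum_volume_carrier_le (by linarith [h.quasi i i])
          fun j hj => h.carrier_subset_closedBall hj hx₀) (sq_nonneg _)
    _ = (M.elem i).diam ^ 2 * ((τ * σ) ^ 2 * (Real.pi * (1 + τ) ^ 2)) := by ring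

variable (M) in
/-- The patch `ω_e = T⁻ ∪ T⁺` of an edge, on which its local lifting is supported. -/
abbrev patch (e : M.EdgeIndex) : Set Plane := (M.minus e).carrier ∪ (M.plus e).carrier

lemma mem_interiorEdges {e : M.EdgeIndex} : e ∈ M.interiorEdges ↔ e.1 < e.2.1 ∧
    (M.minus e).carrier ∩ (M.plus e).carrier = M.edgeSet e ∧
    (∃ b, M.edgeSet e = (M.plus e).edge b) ∧ M.openEdgeSet e ⊆ Ω := by
  simp [interiorEdges]

lemma edgeSet_subset_inter {e : M.EdgeIndex} (he : e ∈ M.interiorEdges) :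
    M.edgeSet e ⊆ (M.minus e).carrier ∩ (M.plus e).carrier :=
  (mem_interiorEdges.1 he).2.1.ge

variable (M) in
lemma edgeSet_nonempty (e : M.EdgeIndex) : (M.edgeSet e).Nonempty :=
  ⟨_, _, left_mem_segment ℝ _ _, rfl⟩

open Classical in
lemma card_le_of_mem_patch {s : Finset M.EdgeIndex} (hs : s ⊆ M.interiorEdges)
    {x : Plane} {m : Fin M.N} (hm : ∀ i, x ∈ (M.elem i).carrier → i = m)
    (hx : ∀ e ∈ s, x ∈ M.patch e) :
    s.card ≤ 4 * (M.neighbours m).card ^ 2 := by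
  have hvertices (c : RefCell) : c.numVertices ≤ 4 := by cases c <;> simp [RefCell.numVertices]
  have hsub : s ⊆ (M.neighbours m).sigma fun _ => M.neighbours m ×ˢ Finset.univ := by
    intro e he
    have hne : ((M.minus e).carrier ∩ (M.plus e).carrier).Nonempty :=
      (M.edgeSet_nonempty e).mono (edgeSet_subset_inter (hs he))
    have hminus : (M.minus e).carrier.Nonempty := hne.mono Set.inter_subset_left
    have hplus : (M.plus e).carrier.Nonempty := hne.mono Set.inter_subset_right
    simp only [Finset.mem_sigma, Finset.mem_product, Finset.mem_univ, and_true, mem_neighbours]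
    rcases hx e he with hx | hx
    · rw [← hm _ hx, Set.inter_self]
      exact ⟨hminus, hne⟩
    · rw [← hm _ hx, Set.inter_self, Set.inter_comm]
      exact ⟨hne, hplus⟩
  calc s.card ≤ ∑ i ∈ M.neighbours m, (M.neighbours m).card * (M.elem i).ref.numVertices := by
        simpa only [Finset.card_sigma, Finset.card_product, Finset.card_univ, Fintype.card_fin]
          using Finset.card_le_card hsub
    _ ≤ ∑ _i ∈ M.neighbours m, (M.neighbours m).card * 4 :=
        Finset.sum_le_sum fun i _ => Nat.mul_le_mul_left _ (hvertices _)
    _ = 4 * (M.neighbours m).card ^ 2 := by rw [Finset.sum_const, smul_eq_mul]; ring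

end IsoMesh

lemma exists_card_le_of_mem_patch (σ τ : ℝ) : ∃ B : ℝ, 0 < B ∧
    ∀ {k : ℕ} {Ω : Set Plane} {M : IsoMesh k Ω}, M.Regular σ τ →
      ∀ {s : Finset M.EdgeIndex}, s ⊆ M.interiorEdges → ∀ {x : Plane} {m : Fin M.N},
        (∀ i, x ∈ (M.elem i).carrier → i = m) →
        (∀ e ∈ s, x ∈ M.patch e) → (s.card : ℝ) ≤ B := by
  obtain ⟨c, hc, hcell⟩ := RefCell.exists_pos_le_volume_cell
  refine ⟨4 * ((τ * σ) ^ 2 * (Real.pi * (1 + τ) ^ 2) / c) ^ 2 + 1, by positivity,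
    fun {k Ω M} hM {s} hs {x m} hm hx => ?_⟩
  have hcard : ((M.neighbours m).card : ℝ) ≤ (τ * σ) ^ 2 * (Real.pi * (1 + τ) ^ 2) / c :=
    (le_div_iff₀ hc).2 (hM.card_neighbours_mul_le hcell m)
  calc (s.card : ℝ) ≤ 4 * ((M.neighbours m).card : ℝ) ^ 2 := by
        exact_mod_cast IsoMesh.card_le_of_mem_patch hs hm hx
    _ ≤ 4 * ((τ * σ) ^ 2 * (Real.pi * (1 + τ) ^ 2) / c) ^ 2 + 1 := by
        linarith [pow_le_pow_left₀ (Nat.cast_nonneg _) hcard 2]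

lemma abs_le_of_sq_le_mul {x a b t : ℝ} (ht : 0 < t) (ha : 0 ≤ a) (hb : 0 ≤ b)
    (h : x ^ 2 ≤ a * b) : |x| ≤ (t * a + t⁻¹ * b) / 2 := by
  refine abs_le_of_sq_le_sq (h.trans ?_) (by positivity)
  have hab : a * b = (t * a) * (t⁻¹ * b) := by field_simp
  rw [hab]
  nlinarith [sq_nonneg (t * a - t⁻¹ * b)]

/-- `C` is a constant in the inverse estimate `‖p‖²_{L^∞} ≤ C ‖p‖²_{L²}` for the polynomials of
degree `l` on both reference cells. -/
def RefCell.InverseConst (l : ℕ) (C : ℝ) : Prop :=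
  0 < C ∧ ∀ s : RefCell, ∀ p ∈ s.polySpace l, ∀ z ∈ s.cell,
    polyEval p z ^ 2 ≤ C * ∫ x in s.cell, polyEval p x ^ 2

lemma RefCell.exists_inverseConst (l : ℕ) : ∃ C, InverseConst l C := by
  choose C hC hbound using fun s : RefCell => s.exists_polyEval_sq_le_mul_setIntegral l
  refine ⟨max (C triangle) (C quadrilateral), lt_max_of_lt_left (hC _), fun s p hp z hz =>
    (hbound s p hp z hz).trans (mul_le_mul_of_nonneg_right ?_
      (integral_nonneg fun _ => sq_nonneg _))⟩
  cases s
  exacts [le_max_left _ _, le_max_right _ _]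

namespace IsoMesh

variable {k : ℕ} {Ω : Set Plane} {M : IsoMesh k Ω} {e : M.EdgeIndex} {l : ℕ}

lemma continuousOn_jumpGrad {v : Plane → ℝ} (hv : v ∈ M.femSpace) (he : e ∈ M.interiorEdges)
    (j : Fin 2) : ContinuousOn (fun x => M.jumpGrad e v x j) (M.edgeSet e) := by
  obtain ⟨hminus, hplus⟩ := Set.subset_inter_iff.1 (edgeSet_subset_inter he)
  exact (((smoothUpTo_of_mem_femSpace hv e.1).grad j).continuousOn_traceFrom.mono hminus).sub
    (((smoothUpTo_of_mem_femSpace hv e.2.1).grad j).continuousOn_traceFrom.mono hplus)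

variable (M) in
lemma isCompact_edgeSet (e : M.EdgeIndex) : IsCompact (M.edgeSet e) :=
  (M.elem e.1).isCompact_edge e.2.2

lemma integrableOn_edgeSet {f : Plane → ℝ} (hf : ContinuousOn f (M.edgeSet e)) :
    IntegrableOn f (M.edgeSet e) μH[1] :=
  hf.integrableOn_of_subset_isCompact (M.isCompact_edgeSet e)
    (M.isCompact_edgeSet e).measurableSet subset_rfl
    ((M.elem e.1).hausdorffMeasure_edge_lt_top e.2.2).ne

lemma continuousOn_dotProduct_self {φ : Plane → Fin 2 → ℝ} {s : Set Plane}
    (hφ : ∀ j, ContinuousOn (fun x => φ x j) s) : ContinuousOn (fun x => φ x ⬝ᵥ φ x) s :=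
  continuousOn_finsetSum _ fun j _ => (hφ j).mul (hφ j)

lemma abs_integral_mulVec_edgeNormal_le {A : Plane → Matrix (Fin 2) (Fin 2) ℝ} {b t : ℝ}
    (hA : ∀ x ∈ M.edgeSet e, frobSq (A x) ≤ b) {φ : Plane → Fin 2 → ℝ}
    (hφ : ∀ j, ContinuousOn (fun x => φ x j) (M.edgeSet e)) (ht : 0 < t) :
    |∫ x in M.edgeSet e, (A x).mulVec (M.edgeNormal e x) ⬝ᵥ φ x ∂μH[1]| ≤
      (t * b * (μH[1]).real (M.edgeSet e) + t⁻¹ * ∫ x in M.edgeSet e, φ x ⬝ᵥ φ x ∂μH[1]) / 2 := by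
  have hconst : IntegrableOn (fun _ => t * b) (M.edgeSet e) μH[1] :=
    integrableOn_edgeSet continuousOn_const
  have hφint := (integrableOn_edgeSet (continuousOn_dotProduct_self hφ)).const_mul t⁻¹
  have hpoint (x : Plane) (hx : x ∈ M.edgeSet e) :
      ‖(A x).mulVec (M.edgeNormal e x) ⬝ᵥ φ x‖ ≤ (t * b + t⁻¹ * (φ x ⬝ᵥ φ x)) / 2 := by
    have hsq : ((A x).mulVec (M.edgeNormal e x) ⬝ᵥ φ x) ^ 2 ≤ frobSq (A x) * (φ x ⬝ᵥ φ x) :=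
      (dotProduct_mulVec_sq_le _ _ _).trans (mul_le_mul_of_nonneg_right
        (mul_le_of_le_one_right (frobSq_nonneg _)
          ((M.elem e.1).unitNormal_dotProduct_self_le_one e.2.2 x)) (dotProduct_self_nonneg _))
    refine (abs_le_of_sq_le_mul ht (frobSq_nonneg _) (dotProduct_self_nonneg _) hsq).trans ?_
    linarith [mul_le_mul_of_nonneg_left (hA x hx) ht.le]
  refine (norm_integral_le_of_norm_le ((hconst.add hφint).div_const 2)
    (ae_restrict_of_forall_mem (M.isCompact_edgeSet e).measurableSet hpoint)).trans_eq ?_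
  rw [integral_div, integral_add' hconst hφint, integral_const_mul t⁻¹, setIntegral_const,
    smul_eq_mul, mul_comm (t * b)]

variable {r : Plane → Matrix (Fin 2) (Fin 2) ℝ}

lemma integrableOn_frobSq_patch (hr : r ∈ M.brokenMatrixSpace l) (e : M.EdgeIndex) :
    IntegrableOn (fun x => frobSq (r x)) (M.patch e) := by
  have hcarrier (i : Fin M.N) : IntegrableOn (fun x => frobSq (r x)) (M.elem i).carrier := by
    have : IsFiniteMeasure (volume.restrict (M.elem i).carrier) :=
      ⟨by simpa using (M.elem i).isCompact_carrier.measure_lt_top⟩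
    have hbdd : IsBoundedField (volume.restrict (M.elem i).carrier) r := fun a b =>
      (smoothUpTo_of_mem_brokenSpace (hr a b) i).memLp_top
    exact hbdd.memLp_frobSq.integrable le_top
  exact (hcarrier e.1).union (hcarrier e.2.1)

lemma setIntegral_apply_sq_le (hr : r ∈ M.brokenMatrixSpace l) {i : Fin M.N}
    (hi : (M.elem i).carrier ⊆ M.patch e) (a b : Fin 2) :
    ∫ x in (M.elem i).carrier, r x a b ^ 2 ≤ ∫ x in M.patch e, frobSq (r x) :=
  calc ∫ x in (M.elem i).carrier, r x a b ^ 2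
      ≤ ∫ x in (M.elem i).carrier, frobSq (r x) :=
        integral_mono_of_nonneg (ae_of_all _ fun _ => sq_nonneg _)
          ((integrableOn_frobSq_patch hr e).mono_set hi)
          (ae_of_all _ fun x => sq_apply_le_frobSq (r x) a b)
    _ ≤ ∫ x in M.patch e, frobSq (r x) :=
        setIntegral_mono_set (integrableOn_frobSq_patch hr e)
          (ae_of_all _ fun _ => frobSq_nonneg _) hi.eventuallyLE

variable {σ τ C : ℝ}

lemma Regular.pos (h : M.Regular σ τ) (i : Fin M.N) : 0 < τ :=
  pos_of_mul_pos_left ((M.elem i).diam_pos.trans_le (h.quasi i i)) (M.elem i).diam_pos.le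

lemma Regular.traceFrom_apply_sq_le (h : M.Regular σ τ) (hC : RefCell.InverseConst l C)
    (hr : r ∈ M.brokenMatrixSpace l) {i : Fin M.N} (hi : (M.elem i).carrier ⊆ M.patch e)
    (a b : Fin 2) {x : Plane} (hx : x ∈ (M.elem i).carrier) :
    traceFrom (M.elem i).openCell (fun z => r z a b) x ^ 2 ≤
      C * σ ^ 2 * (τ ^ 2 * ((M.minus e).diam ^ 2)⁻¹) * ∫ x in M.patch e, frobSq (r x) := by
  obtain ⟨p, hp, hrp⟩ := hr a b i
  have hdiam : ((M.elem i).diam ^ 2)⁻¹ ≤ τ ^ 2 * ((M.minus e).diam ^ 2)⁻¹ := by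
    rw [← div_eq_mul_inv, le_div_iff₀ (pow_pos (M.minus e).diam_pos 2),
      inv_mul_le_iff₀ (pow_pos (M.elem i).diam_pos 2), ← mul_pow, mul_comm]
    exact pow_le_pow_left₀ (M.minus e).diam_pos.le (h.quasi e.1 i) 2
  have hC0 := hC.1.le
  exact ((h.shape i).traceFrom_sq_le hC0 (hC.2 _ p hp) hrp hx).trans
    (mul_le_mul (mul_le_mul_of_nonneg_left hdiam (by positivity))
      (setIntegral_apply_sq_le hr hi a b) (integral_nonneg fun _ => sq_nonneg _) (by positivity))

lemma Regular.frobSq_avgMatrix_le (h : M.Regular σ τ) (hC : RefCell.InverseConst l C)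
    (he : e ∈ M.interiorEdges) (hr : r ∈ M.brokenMatrixSpace l) {x : Plane}
    (hx : x ∈ M.edgeSet e) :
    frobSq (M.avgMatrix e r x) ≤
      4 * (C * σ ^ 2 * (τ ^ 2 * ((M.minus e).diam ^ 2)⁻¹) * ∫ x in M.patch e, frobSq (r x)) := by
  obtain ⟨hminus, hplus⟩ := edgeSet_subset_inter he hx
  have hentry (a b : Fin 2) : M.avgMatrix e r x a b ^ 2 ≤
      C * σ ^ 2 * (τ ^ 2 * ((M.minus e).diam ^ 2)⁻¹) * ∫ x in M.patch e, frobSq (r x) := by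
    have htrace_minus := h.traceFrom_apply_sq_le hC hr (i := e.1) Set.subset_union_left a b hminus
    have htrace_plus := h.traceFrom_apply_sq_le hC hr (i := e.2.1) Set.subset_union_right a b hplus
    simp only [avgMatrix, avg, Matrix.of_apply, minus, plus, div_pow] at htrace_minus htrace_plus ⊢
    linarith [add_sq_le (a := traceFrom (M.elem e.2.1).openCell (fun z => r z a b) x)
      (b := traceFrom (M.elem e.1).openCell (fun z => r z a b) x)]
  rw [frobSq]
  simp only [Fin.sum_univ_two]
  linarith [hentry 0 0, hentry 0 1, hentry 1 0, hentry 1 1]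

lemma Regular.hausdorffMeasure_edgeSet_le (h : M.Regular σ τ) (e : M.EdgeIndex) :
    (μH[1]).real (M.edgeSet e) ≤ 2 * (σ * (M.minus e).diam) :=
  ENNReal.toReal_le_of_le_ofReal
    (mul_nonneg zero_le_two (mul_pos (h.shape e.1).pos (M.minus e).diam_pos).le)
    ((h.shape e.1).hausdorffMeasure_edge_le e.2.2)

variable (M) in
lemma inv_diam_minus_le (e : M.EdgeIndex) : (M.minus e).diam⁻¹ ≤ (M.edgeDiam e)⁻¹ :=
  inv_anti₀ ((M.elem e.1).diam_edge_pos e.2.2) ((M.elem e.1).diam_edge_le_diam e.2.2)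

/- Testing the definition of `r` with `r` itself bounds `∫ |r|²` by an edge integral of `r`, which
the inverse estimate turns back into `∫ |r|²`; Young's inequality absorbs it. -/
lemma Regular.integral_lifting_le (h : M.Regular σ τ) (hC : RefCell.InverseConst l C)
    (he : e ∈ M.interiorEdges) {φ : Plane → Fin 2 → ℝ}
    (hφ : ∀ j, ContinuousOn (fun x => φ x j) (M.edgeSet e)) (hr : M.IsLocalLifting l e φ r) :
    ∫ x in M.patch e, frobSq (r x) ≤ 8 * C * σ ^ 3 * τ ^ 2 *
      ∫ x in M.edgeSet e, (M.edgeDiam e)⁻¹ * (φ x ⬝ᵥ φ x) ∂μH[1] := by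
  obtain ⟨hmem, -, htest⟩ := hr
  have hself : ∫ x in M.edgeSet e, (M.avgMatrix e r x).mulVec (M.edgeNormal e x) ⬝ᵥ φ x ∂μH[1] =
      ∫ x in M.patch e, frobSq (r x) := by
    simpa only [frobInner_self] using (htest r hmem).symm
  have havg := fun x hx => h.frobSq_avgMatrix_le (x := x) hC he hmem hx
  have hlength := h.hausdorffMeasure_edgeSet_le e
  have hedge := M.inv_diam_minus_le e
  have hφ0 : 0 ≤ ∫ x in M.edgeSet e, φ x ⬝ᵥ φ x ∂μH[1] :=
    integral_nonneg fun x => dotProduct_self_nonneg _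
  have hI0 : 0 ≤ ∫ x in M.patch e, frobSq (r x) := integral_nonneg fun _ => frobSq_nonneg _
  set I := ∫ x in M.patch e, frobSq (r x)
  set P := ∫ x in M.edgeSet e, φ x ⬝ᵥ φ x ∂μH[1]
  set d := (M.minus e).diam
  have hd : 0 < d := (M.minus e).diam_pos
  have hσ := (h.shape e.1).pos
  have hτ := h.pos e.1
  have hC0 := hC.1
  have hyoung : I ≤ (I + 8 * C * σ ^ 3 * τ ^ 2 * (d⁻¹ * P)) / 2 :=
    calc I ≤ _ := hself ▸ (le_abs_self _).trans
          (abs_integral_mulVec_edgeNormal_le havg hφ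
            (t := d / (8 * C * σ ^ 3 * τ ^ 2)) (by positivity))
      _ ≤ (d / (8 * C * σ ^ 3 * τ ^ 2) * (4 * (C * σ ^ 2 * (τ ^ 2 * (d ^ 2)⁻¹) * I)) *
            (2 * (σ * d)) + (d / (8 * C * σ ^ 3 * τ ^ 2))⁻¹ * P) / 2 := by gcongr
      _ = (I + 8 * C * σ ^ 3 * τ ^ 2 * (d⁻¹ * P)) / 2 := by field_simp; ring
  calc I ≤ 8 * C * σ ^ 3 * τ ^ 2 * (d⁻¹ * P) := by linarith
    _ ≤ 8 * C * σ ^ 3 * τ ^ 2 * ((M.edgeDiam e)⁻¹ * P) := by gcongr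
    _ = _ := by rw [integral_const_mul]

variable (M) in
lemma jumpNormSq_nonneg (crease : Set Plane) (v : Plane → ℝ) : 0 ≤ M.jumpNormSq crease v :=
  Finset.sum_nonneg fun _ _ => integral_nonneg fun _ =>
    mul_nonneg (inv_nonneg.2 Metric.diam_nonneg) (dotProduct_self_nonneg _)

lemma localLifting_mem (φ : Plane → Fin 2 → ℝ) : M.localLifting l e φ ∈ M.brokenMatrixSpace l := by
  unfold localLifting
  split_ifs with h
  · exact h.choose_spec.1
  · exact fun a b i => ⟨0, Submodule.zero_mem _, fun z _ => by simp [polyEval]⟩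

lemma localLifting_eq_zero (φ : Plane → Fin 2 → ℝ) {x : Plane} (hx : x ∉ M.patch e) :
    M.localLifting l e φ x = 0 := by
  unfold localLifting
  split_ifs with h
  · exact h.choose_spec.2.1 x hx
  · rfl

lemma isBoundedField_localLifting (φ : Plane → Fin 2 → ℝ) :
    IsBoundedField (volume.restrict Ω) (M.localLifting l e φ) := fun a b =>
  memLp_top_of_smoothUpTo fun i => smoothUpTo_of_mem_brokenSpace (localLifting_mem φ a b) i

lemma isBoundedField_brokenHessian {v : Plane → ℝ} (hv : v ∈ M.femSpace) :
    IsBoundedField (volume.restrict Ω) (brokenHessian v) := fun a b =>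
  memLp_top_of_smoothUpTo fun i => ((smoothUpTo_of_mem_femSpace hv i).grad b).grad a

lemma freeEdges_subset (crease : Set Plane) : M.freeEdges crease ⊆ M.interiorEdges := by
  classical exact Finset.filter_subset _ _

/- Where no lifting exists, `localLifting` is `0` and the bound is trivial. -/
lemma Regular.integral_localLifting_le (h : M.Regular σ τ) (hC : RefCell.InverseConst l C)
    (he : e ∈ M.interiorEdges) {φ : Plane → Fin 2 → ℝ}
    (hφ : ∀ j, ContinuousOn (fun x => φ x j) (M.edgeSet e)) :
    ∫ x in Ω, frobSq (M.localLifting l e φ x) ≤ 8 * C * σ ^ 3 * τ ^ 2 *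
      ∫ x in M.edgeSet e, (M.edgeDiam e)⁻¹ * (φ x ⬝ᵥ φ x) ∂μH[1] := by
  have hsupport : Function.support (fun x => frobSq (M.localLifting l e φ x)) ⊆ M.patch e := by
    refine Function.support_subset_iff'.2 fun x hx => ?_
    simp [localLifting_eq_zero φ hx, frobSq]
  refine (setIntegral_le_integral ?_ (ae_of_all _ fun _ => frobSq_nonneg _)).trans ?_
  · exact (integrableOn_iff_integrable_of_support_subset hsupport).1
      (integrableOn_frobSq_patch (localLifting_mem φ) e)
  rw [← setIntegral_eq_integral_of_forall_compl_eq_zero fun x hx =>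
    Function.support_subset_iff'.1 hsupport x hx]
  by_cases hex : ∃ r, M.IsLocalLifting l e φ r
  · refine h.integral_lifting_le hC he hφ ?_
    rw [localLifting, dif_pos hex]
    exact hex.choose_spec
  · have hσ := (h.shape e.1).pos
    have hC0 := hC.1
    simp only [localLifting, dif_neg hex, Pi.zero_apply]
    refine (by simp [frobSq] : _ = (0 : ℝ)).trans_le (mul_nonneg (by positivity)
      (integral_nonneg fun _ => mul_nonneg (inv_nonneg.2 Metric.diam_nonneg)
        (dotProduct_self_nonneg _)))

lemma frobSq_sum_localLifting_le {B : ℝ} {s : Finset M.EdgeIndex} {x : Plane}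
    (hB : ∀ s' ⊆ s, (∀ e ∈ s', x ∈ M.patch e) → (s'.card : ℝ) ≤ B)
    (φ : M.EdgeIndex → Plane → Fin 2 → ℝ) :
    frobSq (∑ e ∈ s, M.localLifting l e (φ e) x) ≤
      B * ∑ e ∈ s, frobSq (M.localLifting l e (φ e) x) := by
  classical
  have hzero (e : M.EdgeIndex) (_ : e ∈ s) (hne : M.localLifting l e (φ e) x ≠ 0) :
      x ∈ M.patch e := by_contra fun hx => hne (localLifting_eq_zero _ hx)
  rw [← Finset.sum_filter_of_ne hzero]
  refine (frobSq_sum_le _ _).trans (mul_le_mul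
    (hB _ (Finset.filter_subset _ _) fun e he => (Finset.mem_filter.1 he).2)
    (Finset.sum_le_sum_of_subset_of_nonneg (Finset.filter_subset _ _) fun _ _ _ => frobSq_nonneg _)
    (Finset.sum_nonneg fun _ _ => frobSq_nonneg _) ?_)
  simpa using hB ∅ (Finset.empty_subset _) (by simp)

end IsoMesh

lemma exists_integral_sum_localLifting_le (l : ℕ) (σ τ : ℝ) : ∃ K : ℝ, 0 ≤ K ∧
    ∀ {k : ℕ} {Ω : Set Plane} {M : IsoMesh k Ω}, M.Regular σ τ →
      ∀ (crease : Set Plane) {v : Plane → ℝ}, v ∈ M.femSpace →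
        ∫ x in Ω, frobSq (∑ e ∈ M.freeEdges crease, M.localLifting l e (M.jumpGrad e v) x) ≤
          K * M.jumpNormSq crease v := by
  obtain ⟨C, hC⟩ := RefCell.exists_inverseConst l
  obtain ⟨B, hB, hcard⟩ := exists_card_le_of_mem_patch σ τ
  refine ⟨B * |8 * C * σ ^ 3 * τ ^ 2|, by positivity, fun {k Ω M} hM crease {v} hv => ?_⟩
  have : IsFiniteMeasure (volume.restrict Ω) := M.isFiniteMeasure_restrict
  have hint : ∀ e ∈ M.freeEdges crease,
      Integrable (fun x => frobSq (M.localLifting l e (M.jumpGrad e v) x)) (volume.restrict Ω) :=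
    fun e _ => (IsoMesh.isBoundedField_localLifting _).memLp_frobSq.integrable le_top
  have hfree := IsoMesh.freeEdges_subset (M := M) crease
  have hoverlap : ∀ᵐ x ∂(volume.restrict Ω),
      frobSq (∑ e ∈ M.freeEdges crease, M.localLifting l e (M.jumpGrad e v) x) ≤
        B * ∑ e ∈ M.freeEdges crease, frobSq (M.localLifting l e (M.jumpGrad e v) x) := by
    filter_upwards [M.ae_existsUnique_mem_carrier] with x hx
    obtain ⟨m, -, hm⟩ := hx
    exact IsoMesh.frobSq_sum_localLifting_le (fun s hs hx => hcard hM (hs.trans hfree) hm hx) _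
  calc ∫ x in Ω, frobSq (∑ e ∈ M.freeEdges crease, M.localLifting l e (M.jumpGrad e v) x)
      ≤ ∫ x in Ω, B * ∑ e ∈ M.freeEdges crease,
          frobSq (M.localLifting l e (M.jumpGrad e v) x) :=
        integral_mono_of_nonneg (ae_of_all _ fun _ => frobSq_nonneg _)
          ((integrable_finsetSum _ hint).const_mul B) hoverlap
    _ = B * ∑ e ∈ M.freeEdges crease,
          ∫ x in Ω, frobSq (M.localLifting l e (M.jumpGrad e v) x) := by
        rw [integral_const_mul, integral_finsetSum _ hint]
    _ ≤ B * (8 * C * σ ^ 3 * τ ^ 2 * M.jumpNormSq crease v) := by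
        rw [IsoMesh.jumpNormSq, Finset.mul_sum (M.freeEdges crease) _ (8 * C * σ ^ 3 * τ ^ 2)]
        exact mul_le_mul_of_nonneg_left (Finset.sum_le_sum fun e he =>
          hM.integral_localLifting_le hC (hfree he)
            (IsoMesh.continuousOn_jumpGrad hv (hfree he))) hB.le
    _ ≤ B * (|8 * C * σ ^ 3 * τ ^ 2| * M.jumpNormSq crease v) :=
        mul_le_mul_of_nonneg_left
          (mul_le_mul_of_nonneg_right (le_abs_self _) (M.jumpNormSq_nonneg crease v)) hB.le
    _ = B * |8 * C * σ ^ 3 * τ ^ 2| * M.jumpNormSq crease v := (mul_assoc _ _ _).symm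

/-- The conjugated field `g^{-1/2} A g^{-1/2}`, in terms of which both energies are written. -/
def conj (g A : Plane → Matrix (Fin 2) (Fin 2) ℝ) (x : Plane) : Matrix (Fin 2) (Fin 2) ℝ :=
  invSqrt (g x) * A x * invSqrt (g x)

section Metric

variable {Ω : Set Plane} {g : Plane → Matrix (Fin 2) (Fin 2) ℝ}

lemma metricSup_nonneg : 0 ≤ metricSup Ω g := ENNReal.toReal_nonneg

lemma metricL1_nonneg : 0 ≤ metricL1 Ω g := integral_nonneg fun _ => frobNorm_nonneg _

namespace IsTargetMetric

lemma isBoundedField (hg : IsTargetMetric Ω g) : IsBoundedField (volume.restrict Ω) g := by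
  obtain ⟨c, hc⟩ := hg.bounded
  refine fun a b => memLp_top_of_bound (hg.aemeasurable a b).aestronglyMeasurable c ?_
  filter_upwards [hc] with x hx
  exact (abs_apply_le_frobNorm _ a b).trans hx

lemma ae_frobNorm_le (hg : IsTargetMetric Ω g) :
    ∀ᵐ x ∂(volume.restrict Ω), frobNorm (g x) ≤ metricSup Ω g := by
  filter_upwards [ae_le_eLpNormEssSup (f := fun x => frobNorm (g x))] with x hx
  rw [← eLpNorm_exponent_top] at hx
  have h := ENNReal.toReal_mono hg.isBoundedField.memLp_frobNorm.2.ne hx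
  rwa [toReal_enorm, Real.norm_of_nonneg (frobNorm_nonneg _)] at h

lemma ae_posDef (hg : IsTargetMetric Ω g) : ∀ᵐ x ∂(volume.restrict Ω), (g x).PosDef := by
  obtain ⟨c, hc, hpos⟩ := hg.pos
  filter_upwards [hpos, hg.symm] with x hx hsymm
  exact posDef_of_le_dotProduct_mulVec hsymm hc hx

lemma metricSup_pos (hg : IsTargetMetric Ω g) (hΩ : volume Ω ≠ 0) : 0 < metricSup Ω g := by
  have : (ae (volume.restrict Ω)).NeBot := ae_restrict_neBot.2 hΩ
  obtain ⟨x, hx, hle⟩ := (hg.ae_posDef.and hg.ae_frobNorm_le).exists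
  calc 0 < g x 0 0 := hx.diag_pos
    _ ≤ frobNorm (g x) := (le_abs_self _).trans (abs_apply_le_frobNorm _ 0 0)
    _ ≤ metricSup Ω g := hle

lemma aemeasurable_invSqrt (hg : IsTargetMetric Ω g) (a b : Fin 2) :
    AEMeasurable (fun x => invSqrt (g x) a b) (volume.restrict Ω) := by
  have h00 := hg.aemeasurable 0 0
  have h01 := hg.aemeasurable 0 1
  have h10 := hg.aemeasurable 1 0
  have h11 := hg.aemeasurable 1 1
  have hdet : AEMeasurable (fun x => √(g x).det) (volume.restrict Ω) := by
    simp only [Matrix.det_fin_two]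
    fun_prop
  have htrace : AEMeasurable (fun x => (g x).trace) (volume.restrict Ω) := by
    simp only [Matrix.trace_fin_two]
    fun_prop
  have hadj : AEMeasurable (fun x => (g x).adjugate a b) (volume.restrict Ω) := by
    simp only [Matrix.adjugate_fin_two]
    fin_cases a <;> fin_cases b
    exacts [h11, h01.neg, h10.neg, h00]
  refine AEMeasurable.congr (f := fun x => (√((g x).trace + 2 * √(g x).det) * √(g x).det)⁻¹ *
    ((g x).adjugate a b + √(g x).det * (1 : Matrix (Fin 2) (Fin 2) ℝ) a b)) (by fun_prop) ?_
  filter_upwards [hg.ae_posDef] with x hx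
  rw [invSqrt_eq hx]
  rfl

lemma isBoundedField_invSqrt (hg : IsTargetMetric Ω g) :
    IsBoundedField (volume.restrict Ω) fun x => invSqrt (g x) := by
  obtain ⟨c, hc, hpos⟩ := hg.pos
  refine fun a b => memLp_top_of_bound (hg.aemeasurable_invSqrt a b).aestronglyMeasurable
    √(2 * metricSup Ω g / c ^ 2) ?_
  filter_upwards [hpos, hg.symm, hg.ae_posDef, hg.ae_frobNorm_le] with x hx hsymm hpd hle
  refine (abs_apply_le_frobNorm _ a b).trans (Real.sqrt_le_sqrt ?_)
  have hentry : ∀ i, g x i i ≤ metricSup Ω g := fun i =>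
    (le_abs_self _).trans ((abs_apply_le_frobNorm _ i i).trans hle)
  have htrace : (g x).trace ≤ 2 * metricSup Ω g := by
    rw [Matrix.trace_fin_two]
    linarith [hentry 0, hentry 1]
  have hdet : c ^ 2 ≤ (g x).det := pow_card_le_det hsymm hc.le hx
  rw [frobSq_invSqrt hpd]
  exact div_le_div₀ (mul_nonneg zero_le_two metricSup_nonneg) htrace (by positivity) hdet

lemma isBoundedField_conj (hg : IsTargetMetric Ω g) {A : Plane → Matrix (Fin 2) (Fin 2) ℝ}
    (hA : IsBoundedField (volume.restrict Ω) A) :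
    IsBoundedField (volume.restrict Ω) (conj g A) :=
  (hg.isBoundedField_invSqrt.mul hA).mul hg.isBoundedField_invSqrt

lemma ae_frobNorm_le_conj (hg : IsTargetMetric Ω g) (A : Plane → Matrix (Fin 2) (Fin 2) ℝ) :
    ∀ᵐ x ∂(volume.restrict Ω), frobNorm (A x) ≤ metricSup Ω g * frobNorm (conj g A x) := by
  filter_upwards [hg.ae_posDef, hg.ae_frobNorm_le] with x hx hle
  calc frobNorm (A x) ≤ √(frobSq (g x) * frobSq (conj g A x)) :=
        Real.sqrt_le_sqrt (frobSq_le_mul_frobSq_conj_invSqrt hx (A x))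
    _ = frobNorm (g x) * frobNorm (conj g A x) := Real.sqrt_mul (frobSq_nonneg _) _
    _ ≤ metricSup Ω g * frobNorm (conj g A x) :=
        mul_le_mul_of_nonneg_right hle (frobNorm_nonneg _)

lemma integral_frobNorm_le (hg : IsTargetMetric Ω g) [IsFiniteMeasure (volume.restrict Ω)]
    {A : Plane → Matrix (Fin 2) (Fin 2) ℝ} (hA : IsBoundedField (volume.restrict Ω) A) :
    ∫ x in Ω, frobNorm (A x) ≤ metricSup Ω g * ∫ x in Ω, frobNorm (conj g A x) := by
  rw [← integral_const_mul]
  exact integral_mono_ae (hA.memLp_frobNorm.integrable le_top)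
    (((hg.isBoundedField_conj hA).memLp_frobNorm.integrable le_top).const_mul _)
    (hg.ae_frobNorm_le_conj A)

lemma integral_frobSq_le (hg : IsTargetMetric Ω g) [IsFiniteMeasure (volume.restrict Ω)]
    {A : Plane → Matrix (Fin 2) (Fin 2) ℝ} (hA : IsBoundedField (volume.restrict Ω) A) :
    ∫ x in Ω, frobSq (A x) ≤ metricSup Ω g ^ 2 * ∫ x in Ω, frobSq (conj g A x) := by
  rw [← integral_const_mul]
  refine integral_mono_ae (hA.memLp_frobSq.integrable le_top)
    (((hg.isBoundedField_conj hA).memLp_frobSq.integrable le_top).const_mul _) ?_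
  filter_upwards [hg.ae_frobNorm_le_conj A] with x hx
  rw [← frobNorm_sq, ← frobNorm_sq, ← mul_pow]
  exact pow_le_pow_left₀ (frobNorm_nonneg _) hx 2

end IsTargetMetric

end Metric

lemma integral_le_sqrt_measureReal_univ_mul_sqrt {α : Type*} [MeasurableSpace α] {ν : Measure α}
    [IsFiniteMeasure ν] {f : α → ℝ} (hf₀ : 0 ≤ᵐ[ν] f) (hf : MemLp f 2 ν) :
    ∫ x, f x ∂ν ≤ √(ν.real Set.univ) * √(∫ x, f x ^ 2 ∂ν) := by
  have h := integral_mul_le_Lp_mul_Lq_of_nonneg Real.HolderConjugate.two_two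
    (ae_of_all ν fun _ => zero_le_one) hf₀ (by simpa using memLp_const (1 : ℝ)) (by simpa using hf)
  simpa [Real.sqrt_eq_rpow] using h

section Stretching

variable {Ω : Set Plane} {g : Plane → Matrix (Fin 2) (Fin 2) ℝ} {y : Fin 3 → Plane → ℝ}

/-- The deviation `∇yᵀ∇y - g` of the first fundamental form of `y` from the target metric. -/
def metricDefect (g : Plane → Matrix (Fin 2) (Fin 2) ℝ) (y : Fin 3 → Plane → ℝ) (x : Plane) :
    Matrix (Fin 2) (Fin 2) ℝ := (jac y x).transpose * jac y x - g x

lemma frobSq_jac_le (x : Plane) :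
    frobSq (jac y x) ≤ √2 * (frobNorm (metricDefect g y x) + frobNorm (g x)) := by
  calc frobSq (jac y x) = (metricDefect g y x).trace + (g x).trace := by
        rw [← trace_transpose_mul_self, ← Matrix.trace_add, metricDefect, sub_add_cancel]
    _ ≤ √2 * frobNorm (metricDefect g y x) + √2 * frobNorm (g x) :=
        add_le_add (trace_le_sqrt_mul_frobNorm _) (trace_le_sqrt_mul_frobNorm _)
    _ = √2 * (frobNorm (metricDefect g y x) + frobNorm (g x)) := (mul_add _ _ _).symm

lemma stretchingEnergy_nonneg {μ lam : ℝ} (hμ : 0 ≤ μ) (hlam : 0 ≤ lam) :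
    0 ≤ stretchingEnergy Ω μ lam g y :=
  mul_nonneg (by norm_num) (integral_nonneg fun _ => add_nonneg
    (mul_nonneg (by positivity) (frobSq_nonneg _)) (mul_nonneg hlam (sq_nonneg _)))

variable {k : ℕ} {M : IsoMesh k Ω}

lemma isBoundedField_jac (hy : y ∈ M.deformationSpace) :
    IsBoundedField (volume.restrict Ω) (jac y) := fun i j =>
  IsoMesh.memLp_top_of_smoothUpTo fun n => (IsoMesh.smoothUpTo_of_mem_femSpace (hy i) n).grad j

lemma isBoundedField_metricDefect (hg : IsTargetMetric Ω g) (hy : y ∈ M.deformationSpace) :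
    IsBoundedField (volume.restrict Ω) (metricDefect g y) :=
  ((isBoundedField_jac hy).transpose.mul (isBoundedField_jac hy)).sub hg.isBoundedField

lemma integral_frobSq_conj_metricDefect_le (hg : IsTargetMetric Ω g)
    (hy : y ∈ M.deformationSpace) {μ lam : ℝ} (hμ : 0 < μ) (hlam : 0 ≤ lam) :
    ∫ x in Ω, frobSq (conj g (metricDefect g y) x) ≤ 4 / μ * stretchingEnergy Ω μ lam g y := by
  have : IsFiniteMeasure (volume.restrict Ω) := M.isFiniteMeasure_restrict
  have hconj := hg.isBoundedField_conj (isBoundedField_metricDefect hg hy)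
  have hsq := (hconj.memLp_frobSq.integrable le_top).const_mul (2 * μ)
  have htrace := (hconj.memLp_trace_sq.integrable le_top).const_mul lam
  have hle : 2 * μ * ∫ x in Ω, frobSq (conj g (metricDefect g y) x) ≤
      8 * stretchingEnergy Ω μ lam g y := by
    rw [← integral_const_mul, stretchingEnergy, ← mul_assoc, mul_one_div_cancel (by norm_num),
      one_mul]
    exact integral_mono hsq (hsq.add htrace) fun _ =>
      le_add_of_nonneg_right (mul_nonneg hlam (sq_nonneg _))
  rw [div_mul_eq_mul_div, le_div_iff₀ hμ]
  linarith

lemma integral_frobNorm_metricDefect_le (hg : IsTargetMetric Ω g) (hy : y ∈ M.deformationSpace)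
    {μ lam : ℝ} (hμ : 0 < μ) (hlam : 0 ≤ lam) :
    ∫ x in Ω, frobNorm (metricDefect g y x) ≤
      2 / √μ * (√(volume.real Ω) * metricSup Ω g * √(stretchingEnergy Ω μ lam g y)) := by
  have : IsFiniteMeasure (volume.restrict Ω) := M.isFiniteMeasure_restrict
  have hdefect := isBoundedField_metricDefect hg hy
  have hholder := integral_le_sqrt_measureReal_univ_mul_sqrt
    (ae_of_all _ fun _ => frobNorm_nonneg _)
    ((hg.isBoundedField_conj hdefect).memLp_frobNorm.mono_exponent le_top)
  simp only [frobNorm_sq, measureReal_restrict_apply_univ] at hholder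
  have hsqrt : √(4 / μ) = 2 / √μ := by
    rw [Real.sqrt_div zero_le_four, (by norm_num : (4 : ℝ) = 2 ^ 2), Real.sqrt_sq zero_le_two]
  have hconj := hholder.trans (mul_le_mul_of_nonneg_left (Real.sqrt_le_sqrt
    (integral_frobSq_conj_metricDefect_le hg hy hμ hlam)) (Real.sqrt_nonneg _))
  rw [Real.sqrt_mul (by positivity), hsqrt] at hconj
  calc ∫ x in Ω, frobNorm (metricDefect g y x)
      ≤ metricSup Ω g * ∫ x in Ω, frobNorm (conj g (metricDefect g y) x) :=
        hg.integral_frobNorm_le hdefect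
    _ ≤ metricSup Ω g *
          (√(volume.real Ω) * (2 / √μ * √(stretchingEnergy Ω μ lam g y))) :=
        mul_le_mul_of_nonneg_left hconj metricSup_nonneg
    _ = 2 / √μ * (√(volume.real Ω) * metricSup Ω g * √(stretchingEnergy Ω μ lam g y)) := by ring

lemma gradNormSq_le (hg : IsTargetMetric Ω g) (hy : y ∈ M.deformationSpace) {μ lam : ℝ}
    (hμ : 0 < μ) (hlam : 0 ≤ lam) :
    gradNormSq Ω y ≤ √2 * (2 / √μ + 1) *
      (√(volume.real Ω) * metricSup Ω g * √(stretchingEnergy Ω μ lam g y) + metricL1 Ω g) := by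
  have : IsFiniteMeasure (volume.restrict Ω) := M.isFiniteMeasure_restrict
  have hdefect : Integrable (fun x => frobNorm (metricDefect g y x)) (volume.restrict Ω) :=
    (isBoundedField_metricDefect hg hy).memLp_frobNorm.integrable le_top
  have hmetric : Integrable (fun x => frobNorm (g x)) (volume.restrict Ω) :=
    hg.isBoundedField.memLp_frobNorm.integrable le_top
  have hle := integral_frobNorm_metricDefect_le hg hy hμ hlam
  generalize hE : √(volume.real Ω) * metricSup Ω g * √(stretchingEnergy Ω μ lam g y) = E at hle ⊢
  have hE₀ : 0 ≤ E := hE ▸ mul_nonneg (mul_nonneg (Real.sqrt_nonneg _) metricSup_nonneg)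
    (Real.sqrt_nonneg _)
  calc gradNormSq Ω y
      ≤ ∫ x in Ω, √2 * (frobNorm (metricDefect g y x) + frobNorm (g x)) :=
        integral_mono ((isBoundedField_jac hy).memLp_frobSq.integrable le_top)
          ((hdefect.add hmetric).const_mul _) frobSq_jac_le
    _ = √2 * ((∫ x in Ω, frobNorm (metricDefect g y x)) + metricL1 Ω g) := by
        rw [integral_const_mul, integral_add hdefect hmetric, metricL1]
    _ ≤ √2 * (2 / √μ * (E + metricL1 Ω g) + (E + metricL1 Ω g)) := by
        gcongr
        · exact hle.trans (by gcongr; exact le_add_of_nonneg_right metricL1_nonneg)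
        · exact le_add_of_nonneg_left hE₀
    _ = √2 * (2 / √μ + 1) * (E + metricL1 Ω g) := by ring

lemma gradNormSq_sq_le (hg : IsTargetMetric Ω g) (hy : y ∈ M.deformationSpace) {μ lam : ℝ}
    (hμ : 0 < μ) (hlam : 0 ≤ lam) :
    gradNormSq Ω y ^ 2 ≤ 4 * (2 / √μ + 1) ^ 2 *
      (volume.real Ω * metricSup Ω g ^ 2 * stretchingEnergy Ω μ lam g y + metricL1 Ω g ^ 2) := by
  have hE := stretchingEnergy_nonneg (Ω := Ω) (g := g) (y := y) hμ.le hlam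
  calc gradNormSq Ω y ^ 2
      ≤ (√2 * (2 / √μ + 1) * (√(volume.real Ω) * metricSup Ω g *
          √(stretchingEnergy Ω μ lam g y) + metricL1 Ω g)) ^ 2 :=
        pow_le_pow_left₀ (integral_nonneg fun _ => frobSq_nonneg _)
          (gradNormSq_le hg hy hμ hlam) 2
    _ ≤ (√2 * (2 / √μ + 1)) ^ 2 * (2 * ((√(volume.real Ω) * metricSup Ω g *
          √(stretchingEnergy Ω μ lam g y)) ^ 2 + metricL1 Ω g ^ 2)) := by
        rw [mul_pow]
        exact mul_le_mul_of_nonneg_left add_sq_le (sq_nonneg _)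
    _ = _ := by
        rw [mul_pow, mul_pow, mul_pow, Real.sq_sqrt zero_le_two, Real.sq_sqrt measureReal_nonneg,
          Real.sq_sqrt hE]
        ring

end Stretching

namespace IsoMesh

variable {Ω : Set Plane} {g : Plane → Matrix (Fin 2) (Fin 2) ℝ} {k : ℕ} {M : IsoMesh k Ω}
  {y : Fin 3 → Plane → ℝ} (crease : Set Plane) (l : ℕ)

lemma isBoundedField_discreteHessian {v : Plane → ℝ} (hv : v ∈ M.femSpace) :
    IsBoundedField (volume.restrict Ω) (M.discreteHessian crease l v) :=
  (isBoundedField_brokenHessian hv).sub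
    (IsBoundedField.sum fun _ _ => isBoundedField_localLifting _)

lemma bendingEnergy_nonneg {μ lam γ : ℝ} (hμ : 0 < μ) (hlam : 0 ≤ lam) (hγ : 0 ≤ γ) :
    0 ≤ M.bendingEnergy crease l μ lam γ g y := by
  refine add_nonneg (mul_nonneg (by norm_num) (integral_nonneg fun x => ?_))
    (mul_nonneg (by positivity) (Finset.sum_nonneg fun m _ => M.jumpNormSq_nonneg crease _))
  exact add_nonneg (mul_nonneg (by positivity) (Finset.sum_nonneg fun _ _ => frobSq_nonneg _))
    (mul_nonneg (by positivity) (Finset.sum_nonneg fun _ _ => sq_nonneg _))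

lemma le_bendingEnergy (hg : IsTargetMetric Ω g) (hy : y ∈ M.deformationSpace) {μ lam γ : ℝ}
    (hμ : 0 < μ) (hlam : 0 ≤ lam) :
    μ / 12 * (∑ m, ∫ x in Ω, frobSq (conj g (M.discreteHessian crease l (y m)) x)) +
      γ / 2 * ∑ m, M.jumpNormSq crease (y m) ≤ M.bendingEnergy crease l μ lam γ g y := by
  have : IsFiniteMeasure (volume.restrict Ω) := M.isFiniteMeasure_restrict
  have hconj := fun m => hg.isBoundedField_conj (isBoundedField_discreteHessian crease l (hy m))
  have hsq := fun m => (hconj m).memLp_frobSq.integrable le_top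
  have hsum := (integrable_finsetSum Finset.univ fun m _ => hsq m).const_mul (2 * μ)
  have htrace := (integrable_finsetSum Finset.univ fun m _ =>
    (hconj m).memLp_trace_sq.integrable le_top).const_mul (2 * μ * lam / (2 * μ + lam))
  refine add_le_add_left ?_ _
  calc μ / 12 * (∑ m, ∫ x in Ω, frobSq (conj g (M.discreteHessian crease l (y m)) x))
      = 1 / 24 * ∫ x in Ω,
          2 * μ * ∑ m, frobSq (conj g (M.discreteHessian crease l (y m)) x) := by
        rw [integral_const_mul, integral_finsetSum _ fun m _ => hsq m]
        ring
    _ ≤ _ := mul_le_mul_of_nonneg_left (integral_mono hsum (hsum.add htrace) fun _ =>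
        le_add_of_nonneg_right (mul_nonneg (by positivity)
          (Finset.sum_nonneg fun _ _ => sq_nonneg _))) (by norm_num)

lemma integral_frobSq_brokenHessian_le {v : Plane → ℝ} (hv : v ∈ M.femSpace) :
    ∫ x in Ω, frobSq (brokenHessian v x) ≤
      2 * (∫ x in Ω, frobSq (M.discreteHessian crease l v x)) +
        2 * ∫ x in Ω, frobSq (∑ e ∈ M.freeEdges crease, M.localLifting l e (M.jumpGrad e v) x) := by
  have : IsFiniteMeasure (volume.restrict Ω) := M.isFiniteMeasure_restrict
  have hdiscrete : Integrable (fun x => 2 * frobSq (M.discreteHessian crease l v x))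
      (volume.restrict Ω) :=
    ((isBoundedField_discreteHessian crease l hv).memLp_frobSq.integrable le_top).const_mul 2
  have hlifting : Integrable (fun x => 2 * frobSq (∑ e ∈ M.freeEdges crease,
      M.localLifting l e (M.jumpGrad e v) x)) (volume.restrict Ω) :=
    ((IsBoundedField.sum fun _ _ =>
      isBoundedField_localLifting _).memLp_frobSq.integrable le_top).const_mul 2
  rw [← integral_const_mul, ← integral_const_mul, ← integral_add hdiscrete hlifting]
  refine integral_mono ((isBoundedField_brokenHessian hv).memLp_frobSq.integrable le_top)
    (hdiscrete.add hlifting) fun x => ?_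
  calc frobSq (brokenHessian v x) = frobSq (M.discreteHessian crease l v x +
        ∑ e ∈ M.freeEdges crease, M.localLifting l e (M.jumpGrad e v) x) := by
        rw [discreteHessian, sub_add_cancel]
    _ ≤ _ := frobSq_add_le _ _

lemma seminormSq_le (hg : IsTargetMetric Ω g) {v : Plane → ℝ} (hv : v ∈ M.femSpace) {K : ℝ}
    (hK : ∫ x in Ω, frobSq (∑ e ∈ M.freeEdges crease, M.localLifting l e (M.jumpGrad e v) x) ≤
      K * M.jumpNormSq crease v) :
    M.seminormSq crease v ≤
      2 * metricSup Ω g ^ 2 * (∫ x in Ω, frobSq (conj g (M.discreteHessian crease l v) x)) +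
        (2 * K + 1) * M.jumpNormSq crease v := by
  have : IsFiniteMeasure (volume.restrict Ω) := M.isFiniteMeasure_restrict
  rw [seminormSq]
  linarith [integral_frobSq_brokenHessian_le crease l hv,
    hg.integral_frobSq_le (isBoundedField_discreteHessian crease l hv)]

lemma deformationSeminormSq_le (hg : IsTargetMetric Ω g) (hy : y ∈ M.deformationSpace) {K : ℝ}
    (hK₀ : 0 ≤ K)
    (hK : ∀ {v}, v ∈ M.femSpace → ∫ x in Ω, frobSq (∑ e ∈ M.freeEdges crease,
      M.localLifting l e (M.jumpGrad e v) x) ≤ K * M.jumpNormSq crease v)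
    {μ lam γ : ℝ} (hμ : 0 < μ) (hlam : 0 ≤ lam) (hγ : 0 < γ) :
    M.deformationSeminormSq crease y ≤
      (24 * metricSup Ω g ^ 2 / μ + 2 * (2 * K + 1) * γ⁻¹) *
        M.bendingEnergy crease l μ lam γ g y := by
  have henergy := le_bendingEnergy crease l hg hy (γ := γ) hμ hlam
  have hsum : M.deformationSeminormSq crease y ≤ 2 * metricSup Ω g ^ 2 *
      (∑ m, ∫ x in Ω, frobSq (conj g (M.discreteHessian crease l (y m)) x)) +
        (2 * K + 1) * ∑ m, M.jumpNormSq crease (y m) := by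
    rw [Finset.mul_sum, Finset.mul_sum, ← Finset.sum_add_distrib]
    exact Finset.sum_le_sum fun m _ => seminormSq_le crease l hg (hy m) (hK (hy m))
  have hX₀ : 0 ≤ ∑ m, ∫ x in Ω, frobSq (conj g (M.discreteHessian crease l (y m)) x) :=
    Finset.sum_nonneg fun _ _ => integral_nonneg fun _ => frobSq_nonneg _
  have hJ₀ : 0 ≤ ∑ m, M.jumpNormSq crease (y m) :=
    Finset.sum_nonneg fun _ _ => M.jumpNormSq_nonneg crease _
  generalize (∑ m, ∫ x in Ω, frobSq (conj g (M.discreteHessian crease l (y m)) x)) = X at *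
  generalize (∑ m, M.jumpNormSq crease (y m)) = J at *
  generalize M.bendingEnergy crease l μ lam γ g y = E at *
  have hX : X ≤ 12 / μ * E := by
    rw [div_mul_eq_mul_div, le_div_iff₀ hμ]
    linarith [mul_nonneg hγ.le hJ₀]
  have hJ : J ≤ 2 / γ * E := by
    rw [div_mul_eq_mul_div, le_div_iff₀ hγ]
    linarith [mul_nonneg hμ.le hX₀]
  calc M.deformationSeminormSq crease y
      ≤ 2 * metricSup Ω g ^ 2 * X + (2 * K + 1) * J := hsum
    _ ≤ 2 * metricSup Ω g ^ 2 * (12 / μ * E) + (2 * K + 1) * (2 / γ * E) := by gcongr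
    _ = (24 * metricSup Ω g ^ 2 / μ + 2 * (2 * K + 1) * γ⁻¹) * E := by ring

lemma deformationSeminormSq_of_empty (M : IsoMesh k ∅) (crease : Set Plane)
    (y : Fin 3 → Plane → ℝ) : M.deformationSeminormSq crease y = 0 := by
  have hfree : M.freeEdges crease = ∅ := by
    refine Finset.eq_empty_of_forall_notMem fun e he => ?_
    exact (mem_interiorEdges.1 (freeEdges_subset crease he)).2.2.2
      (Set.mem_image_of_mem _ (midpoint_mem_openSegment _ _))
  simp [deformationSeminormSq, seminormSq, jumpNormSq, hfree]

end IsoMesh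

section Family

variable {Ω : Set Plane} {g : Plane → Matrix (Fin 2) (Fin 2) ℝ} {k : ℕ} {ι : Type}
  {M : ι → IsoMesh k Ω}

lemma exists_forall_regular (hs : ShapeRegular M) (hq : QuasiUniform M) :
    ∃ σ τ : ℝ, ∀ h, (M h).Regular σ τ := by
  obtain ⟨σ, hσ⟩ := hs
  obtain ⟨τ, hτ⟩ := hq
  exact ⟨σ, τ, fun h => ⟨hσ h, hτ h⟩⟩

lemma exists_deformationSeminormSq_le (hΩ : IsOpen Ω) (hg : IsTargetMetric Ω g)
    (crease : Set Plane) {μ lam : ℝ} (hμ : 0 < μ) (hlam : 0 ≤ lam) (l : ℕ)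
    (hs : ShapeRegular M) (hq : QuasiUniform M) :
    ∃ C : ℝ → ℝ, (∀ γ, 0 < γ → 0 < C γ) ∧ Tendsto C (𝓝[>] 0) atTop ∧
      ∀ γ : ℝ, 0 < γ → ∀ h, ∀ y ∈ (M h).deformationSpace,
        (M h).deformationSeminormSq crease y ≤
          C γ * (metricSup Ω g * (M h).bendingEnergy crease l μ lam γ g y) := by
  rcases Ω.eq_empty_or_nonempty with rfl | hne
  · refine ⟨fun γ => γ⁻¹, fun γ hγ => inv_pos.2 hγ, tendsto_inv_nhdsGT_zero,
      fun γ hγ h y _ => ?_⟩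
    rw [IsoMesh.deformationSeminormSq_of_empty]
    exact mul_nonneg (inv_pos.2 hγ).le
      (mul_nonneg metricSup_nonneg (IsoMesh.bendingEnergy_nonneg crease l hμ hlam hγ.le))
  obtain ⟨σ, τ, hreg⟩ := exists_forall_regular hs hq
  obtain ⟨K, hK₀, hK⟩ := exists_integral_sum_localLifting_le l σ τ
  have hG : 0 < metricSup Ω g := hg.metricSup_pos (hΩ.measure_pos volume hne).ne'
  refine ⟨fun γ => 24 * metricSup Ω g / μ + 2 * (2 * K + 1) / metricSup Ω g * γ⁻¹,
    fun γ hγ => by positivity, tendsto_atTop_add_const_left _ _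
      (tendsto_inv_nhdsGT_zero.const_mul_atTop (by positivity)), fun γ hγ h y hy => ?_⟩
  refine (IsoMesh.deformationSeminormSq_le crease l hg hy hK₀ (hK (hreg h) crease)
    hμ hlam hγ).trans_eq ?_
  field_simp

lemma exists_gradNormSq_sq_add_le (hΩ : IsOpen Ω) (hg : IsTargetMetric Ω g)
    (crease : Set Plane) {μ lam γ : ℝ} (hμ : 0 < μ) (hlam : 0 ≤ lam) (hγ : 0 < γ) (l : ℕ)
    (hs : ShapeRegular M) (hq : QuasiUniform M) :
    ∃ K : ℝ, 0 < K ∧ ∀ θ : ℝ, ∀ h, ∀ y ∈ (M h).deformationSpace,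
      gradNormSq Ω y ^ 2 + θ ^ 2 * (M h).deformationSeminormSq crease y ≤
        K * ((M h).energy crease l μ lam γ θ g y + metricL1 Ω g ^ 2) := by
  obtain ⟨C, hC, -, hbend⟩ := exists_deformationSeminormSq_le hΩ hg crease hμ hlam l hs hq
  have hCγ := hC γ hγ
  have hG : 0 ≤ metricSup Ω g := metricSup_nonneg
  refine ⟨4 * (2 / √μ + 1) ^ 2 * (volume.real Ω * metricSup Ω g ^ 2 + 1) + C γ * metricSup Ω g,
    by positivity, fun θ h y hy => ?_⟩
  set S := stretchingEnergy Ω μ lam g y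
  set B := (M h).bendingEnergy crease l μ lam γ g y
  set T := (M h).energy crease l μ lam γ θ g y + metricL1 Ω g ^ 2
  have hS : 0 ≤ S := stretchingEnergy_nonneg hμ.le hlam
  have hB : 0 ≤ θ ^ 2 * B :=
    mul_nonneg (sq_nonneg θ) (IsoMesh.bendingEnergy_nonneg crease l hμ hlam hγ.le)
  have hT : T = S + θ ^ 2 * B + metricL1 Ω g ^ 2 := rfl
  have hL := sq_nonneg (metricL1 Ω g)
  have hST : S ≤ T := by linarith
  have hBT : θ ^ 2 * B ≤ T := by linarith
  have hLT : metricL1 Ω g ^ 2 ≤ T := by linarith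
  calc gradNormSq Ω y ^ 2 + θ ^ 2 * (M h).deformationSeminormSq crease y
      ≤ 4 * (2 / √μ + 1) ^ 2 * (volume.real Ω * metricSup Ω g ^ 2 * S + metricL1 Ω g ^ 2) +
          θ ^ 2 * (C γ * (metricSup Ω g * B)) :=
        add_le_add (gradNormSq_sq_le hg hy hμ hlam)
          (mul_le_mul_of_nonneg_left (hbend γ hγ h y hy) (sq_nonneg θ))
    _ = 4 * (2 / √μ + 1) ^ 2 * (volume.real Ω * metricSup Ω g ^ 2 * S + metricL1 Ω g ^ 2) +
          C γ * metricSup Ω g * (θ ^ 2 * B) := by ring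
    _ ≤ 4 * (2 / √μ + 1) ^ 2 * (volume.real Ω * metricSup Ω g ^ 2 * T + T) +
          C γ * metricSup Ω g * T := by gcongr
    _ = _ := by ring

end Family

end PrestrainedPlate

end

theorem mainTheorem7_general :
    (∀ μ : ℝ, 0 < μ → ∃ C : ℝ, 0 < C ∧
      ∀ lam : ℝ, 0 ≤ lam →
      ∀ (Ω : Set Plane) (g : Plane → Matrix (Fin 2) (Fin 2) ℝ), IsTargetMetric Ω g →
      ∀ (k : ℕ) (M : IsoMesh k Ω), ∀ y ∈ M.deformationSpace,
        gradNormSq Ω y ≤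
          C * (√(volume.real Ω) * metricSup Ω g * √(stretchingEnergy Ω μ lam g y) +
            metricL1 Ω g)) ∧
    (∀ Ω : Set Plane, IsOpen Ω →
      ∀ g : Plane → Matrix (Fin 2) (Fin 2) ℝ, IsTargetMetric Ω g →
      ∀ (crease : Set Plane) (μ lam : ℝ), 0 < μ → 0 ≤ lam →
      ∀ (k l : ℕ) (ι : Type) (M : ι → IsoMesh k Ω), ShapeRegular M → QuasiUniform M →
      ∃ C : ℝ → ℝ, (∀ γ, 0 < γ → 0 < C γ) ∧ Tendsto C (𝓝[>] 0) atTop ∧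
        ∀ γ : ℝ, 0 < γ → ∀ h, ∀ y ∈ (M h).deformationSpace,
          (M h).deformationSeminormSq crease y ≤
            C γ * (metricSup Ω g * (M h).bendingEnergy crease l μ lam γ g y)) ∧
    (∀ Ω : Set Plane, IsOpen Ω →
      ∀ g : Plane → Matrix (Fin 2) (Fin 2) ℝ, IsTargetMetric Ω g →
      ∃ C : ℝ, 0 ≤ C ∧
        ∀ (crease : Set Plane) (μ lam γ : ℝ), 0 < μ → 0 ≤ lam → 0 < γ →
        ∀ (k l : ℕ) (ι : Type) (M : ι → IsoMesh k Ω), ShapeRegular M → QuasiUniform M →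
        ∃ K : ℝ, 0 < K ∧
          ∀ θ : ℝ, ∀ h, ∀ y ∈ (M h).deformationSpace,
            gradNormSq Ω y ^ 2 + θ ^ 2 * (M h).deformationSeminormSq crease y ≤
              K * ((M h).energy crease l μ lam γ θ g y + C)) :=
  ⟨fun μ hμ => ⟨√2 * (2 / √μ + 1), by positivity, fun _ hlam _ _ hg _ _ _ hy =>
      gradNormSq_le hg hy hμ hlam⟩,
    fun _ hΩ _ hg crease _ _ hμ hlam _ l _ _ hs hq =>
      exists_deformationSeminormSq_le hΩ hg crease hμ hlam l hs hq,
    fun Ω hΩ g hg => ⟨metricL1 Ω g ^ 2, sq_nonneg _,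
      fun crease _ _ _ hμ hlam hγ _ l _ _ hs hq =>
        exists_gradNormSq_sq_add_le hΩ hg crease hμ hlam hγ l hs hq⟩⟩

theorem mainTheorem7 :
    -- the gradient bound; the constant depends only on `μ`
    (∀ μ : ℝ, 0 < μ → ∃ C : ℝ, 0 < C ∧
      ∀ lam : ℝ, 0 ≤ lam →
      ∀ Ω : Set Plane, IsOpen Ω → Bornology.IsBounded Ω →
      ∀ g : Plane → Matrix (Fin 2) (Fin 2) ℝ, IsTargetMetric Ω g →
      ∀ k : ℕ, 2 ≤ k → ∀ M : IsoMesh k Ω, ∀ y ∈ M.deformationSpace,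
        gradNormSq Ω y ≤
          C * (√(volume.real Ω) * metricSup Ω g * √(stretchingEnergy Ω μ lam g y) +
            metricL1 Ω g)) ∧
    -- the discrete second-order bound; the constant does not depend on the mesh
    (∀ Ω : Set Plane, IsOpen Ω → Bornology.IsBounded Ω →
      ∀ g : Plane → Matrix (Fin 2) (Fin 2) ℝ, IsTargetMetric Ω g →
      ∀ crease : Set Plane, crease ⊆ Ω →
      ∀ μ lam : ℝ, 0 < μ → 0 ≤ lam →
      ∀ k l : ℕ, 2 ≤ k →
      ∀ (ι : Type) (M : ι → IsoMesh k Ω), ShapeRegular M → QuasiUniform M →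
        (∀ h, (M h).Resolves crease) →
      ∃ C : ℝ → ℝ, (∀ γ, 0 < γ → 0 < C γ) ∧ Tendsto C (𝓝[>] 0) atTop ∧
        ∀ γ : ℝ, 0 < γ → ∀ h, ∀ y ∈ (M h).deformationSpace,
          (M h).deformationSeminormSq crease y ≤
            C γ * (metricSup Ω g * (M h).bendingEnergy crease l μ lam γ g y)) ∧
    -- the combined bound; the additive constant `C` depends only on `Ω` and `g`, and the
    -- multiplicative constant `K` does not depend on the mesh or on the thickness `θ`
    (∀ Ω : Set Plane, IsOpen Ω → Bornology.IsBounded Ω →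
      ∀ g : Plane → Matrix (Fin 2) (Fin 2) ℝ, IsTargetMetric Ω g →
      ∃ C : ℝ, 0 ≤ C ∧
        ∀ crease : Set Plane, crease ⊆ Ω →
        ∀ μ lam γ : ℝ, 0 < μ → 0 ≤ lam → 0 < γ →
        ∀ k l : ℕ, 2 ≤ k →
        ∀ (ι : Type) (M : ι → IsoMesh k Ω), ShapeRegular M → QuasiUniform M →
          (∀ h, (M h).Resolves crease) →
        ∃ K : ℝ, 0 < K ∧
          ∀ θ : ℝ, 0 < θ → ∀ h, ∀ y ∈ (M h).deformationSpace,
            gradNormSq Ω y ^ 2 + θ ^ 2 * (M h).deformationSeminormSq crease y ≤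
              K * ((M h).energy crease l μ lam γ θ g y + C)) := by
  obtain ⟨hgrad, hbend, hboth⟩ := mainTheorem7_general
  exact ⟨fun μ hμ => (hgrad μ hμ).imp fun _ hC => ⟨hC.1, fun lam hlam Ω _ _ g hg k _ =>
      hC.2 lam hlam Ω g hg k⟩,
    fun Ω hΩ _ g hg crease _ μ lam hμ hlam k l _ ι M hs hq _ =>
      hbend Ω hΩ g hg crease μ lam hμ hlam k l ι M hs hq,
    fun Ω hΩ _ g hg => (hboth Ω hΩ g hg).imp fun _ hC => ⟨hC.1,
      fun crease _ μ lam γ hμ hlam hγ k l _ ι M hs hq _ =>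
        (hC.2 crease μ lam γ hμ hlam hγ k l ι M hs hq).imp fun _ hK => ⟨hK.1, fun θ _ => hK.2 θ⟩⟩⟩
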